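/- Let $r\ge 1$ be an integer and $\alpha_1,\alpha_2,\sigma_0^2>0$. For every $n\ge1$ let $X_n$ be a (deterministic) real $n\times p_n$ matrix. Let $\boldsymbol t$ be a fixed finite set of indices with $\boldsymbol t\subseteq\{1,\dots,p_n\}$ for all $n$, and let $\beta_0\in\mathbb R^{p_n}$ be the vector whose coordinates in $\boldsymbol t$ are fixed nonzero numbers not depending on $n$ and whose other coordinates are $0$. The data are $\boldsymbol y_n=X_n\beta_0+\boldsymbol\epsilon_n$, where the $n$ coordinates of $\boldsymbol\epsilon_n$ are i.i.d. $N(0,\sigma_0^2)$. A model is a subset $\boldsymbol k\subseteq\{1,\dots,p_n\}$; $X_k$ is the submatrix of the columns of $X_n$ with index in $\boldsymbol k$. Let $\pi=\pi_n$ be a prior probability distribution on the models, and consider the hierarchical model $$\boldsymbol Y_n\mid\beta_k,\tau,\sigma^2,\boldsymbol k\sim N(X_k\beta_k,\sigma^2I_n),$$ $$\pi(\beta_k\mid\tau,\sigma^2,\boldsymbol k)=\frac{(\tau\sigma^2)^{r|\boldsymbol k|/2}}{\Gamma(r/2)^{|\boldsymbol k|}}\prod_{i\in\boldsymbol k}|\beta_i|^{-(r+1)}\exp\Big(-\frac{\tau\sigma^2}{\beta_i^2}\Big),$$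 $$\pi(\tau)=\frac{(n/2)^{1/2}}{\Gamma(1/2)}\tau^{-3/2}e^{-n/(2\tau)},\qquad \pi(\sigma^2)=\frac{\alpha_2^{\alpha_1}}{\Gamma(\alpha_1)}(\sigma^2)^{-(\alpha_1+1)}e^{-\alpha_2/\sigma^2}\qquad(\tau,\sigma^2>0).$$ Let $m_{\boldsymbol k}(\boldsymbol y_n)$ be the marginal density of the data under $\boldsymbol k$ (the integral over $\beta_k\in\mathbb R^{\boldsymbol k}$, $\sigma^2>0$ and $\tau>0$ of the product of these four densities), and let $\pi(\boldsymbol k\mid\boldsymbol y_n)=\pi(\boldsymbol k)m_{\boldsymbol k}(\boldsymbol y_n)/\sum_{\boldsymbol l}\pi(\boldsymbol l)m_{\boldsymbol l}(\boldsymbol y_n)$ be the posterior probability of $\boldsymbol k$. Assume: 1. There are $\epsilon_n\in(0,1)$ with $\epsilon_n^{-1}=O((\log n)^{1/8})$ such that for every $n\ge 1$ and every model $\boldsymbol k$ the $\min(n,|\boldsymbol k|)$ largest eigenvalues (with multiplicity) of $X_k^TX_k/n$ all lie in $[\epsilon_n,\epsilon_n^{-1}]$. 2. $p_n=O(n^\gamma)$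 with $\gamma<r$. 3. $\pi(\boldsymbol k)=0$ whenever $|\boldsymbol k|>q_n$, where $q_n=O(n^\xi)$ with $\xi<1$ and $\xi<1-\frac{4\gamma}{3r}$. 4. There is a constant $\omega>0$, not depending on $n$, such that $\pi(\boldsymbol t)/\pi(\boldsymbol k)>\omega$ for every $n$ and every $\boldsymbol k$ with $\pi(\boldsymbol k)>0$. Then $\pi(\boldsymbol t\mid\boldsymbol y_n)\to1$ in probability as $n\to\infty$. -/

import Mathlib

open MeasureTheory ProbabilityTheory Filter Topology Asymptotics
open scoped NNReal ENNReal Matrix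

namespace HyperPiMOM

/-- The submatrix `X_k` of the columns of the design matrix `X` that belong to the model `k`. -/
def modelMatrix {n p : ℕ} (X : Matrix (Fin n) (Fin p) ℝ) (k : Finset (Fin p)) :
    Matrix (Fin n) k ℝ :=
  X.submatrix id (fun j : k => (j : Fin p))

/-- The scaled Gram matrix `X_kᵀ X_k / n`. -/
noncomputable def gram {n p : ℕ} (X : Matrix (Fin n) (Fin p) ℝ) (k : Finset (Fin p)) :
    Matrix k k ℝ :=
  (1 / (n : ℝ)) • ((modelMatrix X k)ᵀ * modelMatrix X k)

theorem gram_isHermitian {n p : ℕ} (X : Matrix (Fin n) (Fin p) ℝ) (k : Finset (Fin p)) :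
    (gram X k).IsHermitian := by
  unfold Matrix.IsHermitian gram
  simp [Matrix.conjTranspose_eq_transpose_of_trivial, Matrix.transpose_mul]

/-- The eigenvalues of `X_kᵀ X_k / n`, with multiplicity and in decreasing order; the index `j`
starts at `0`, so `nu X k j` is the `(j+1)`-st largest eigenvalue. -/
noncomputable def nu {n p : ℕ} (X : Matrix (Fin n) (Fin p) ℝ) (k : Finset (Fin p))
    (j : Fin (Fintype.card k)) : ℝ :=
  (gram_isHermitian X k).eigenvalues₀ j

/-- For every model `k`, the `min(n, |k|)` largest eigenvalues of `X_kᵀ X_k / n` (the only ones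
that can be nonzero) all lie in `[ε, ε⁻¹]`. -/
def EigenvalueBounds {n p : ℕ} (X : Matrix (Fin n) (Fin p) ℝ) (ε : ℝ) : Prop :=
  ∀ (k : Finset (Fin p)) (j : Fin (Fintype.card k)), (j : ℕ) < n →
    ε ≤ nu X k j ∧ nu X k j ≤ ε⁻¹

/-- The true model `t`: the positions of the nonzero coordinates of `β₀`. -/
def trueModel (p : ℕ) (β₀ : ℕ →₀ ℝ) : Finset (Fin p) :=
  {i : Fin p | (i : ℕ) ∈ β₀.support}

/-- The density at `y` of the normal distribution `N(X_k β, s I_n)`, where `s` is the variance. -/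
noncomputable def likelihood {n p : ℕ} (X : Matrix (Fin n) (Fin p) ℝ) (k : Finset (Fin p))
    (s : ℝ) (β : k → ℝ) (y : Fin n → ℝ) : ℝ :=
  (2 * Real.pi * s) ^ (-((n : ℝ) / 2)) *
    Real.exp (-(∑ i, (y i - (modelMatrix X k *ᵥ β) i) ^ 2) / (2 * s))

/-- The product piMOM density of order `r` with scale `τ` and variance `s`. -/
noncomputable def piMOM {ι : Type*} [Fintype ι] (r : ℕ) (τ s : ℝ) (β : ι → ℝ) : ℝ :=
  ∏ i, (τ * s) ^ ((r : ℝ) / 2) / Real.Gamma ((r : ℝ) / 2) *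
    (|β i| ^ (r + 1))⁻¹ * Real.exp (-(τ * s) / (β i) ^ 2)

/-- The density at `x > 0` of the inverse gamma distribution with shape `a` and scale `b`. -/
noncomputable def invGamma (a b x : ℝ) : ℝ :=
  b ^ a / Real.Gamma a * x ^ (-(a + 1)) * Real.exp (-b / x)

/-- The marginal density `m_k(y)` of the data under the model `k`: the likelihood is integrated
against the piMOM prior on the coefficients, the inverse gamma prior with shape `1/2` and scale
`n/2` on `τ`, and the inverse gamma prior with shape `α₁` and scale `α₂` on the variance `s`. -/
noncomputable def marginal {n p : ℕ} (r : ℕ) (α₁ α₂ : ℝ) (X : Matrix (Fin n) (Fin p) ℝ)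
    (k : Finset (Fin p)) (y : Fin n → ℝ) : ℝ≥0∞ :=
  ∫⁻ τ in Set.Ioi (0 : ℝ), ∫⁻ s in Set.Ioi (0 : ℝ), ∫⁻ β : k → ℝ,
    ENNReal.ofReal (likelihood X k s β y * piMOM r τ s β *
      invGamma (1 / 2) ((n : ℝ) / 2) τ * invGamma α₁ α₂ s)

/-- The posterior probability of the model `k` given the data `y`, by Bayes' rule. -/
noncomputable def posterior {n p : ℕ} (r : ℕ) (α₁ α₂ : ℝ) (prior : PMF (Finset (Fin p)))
    (X : Matrix (Fin n) (Fin p) ℝ) (k : Finset (Fin p)) (y : Fin n → ℝ) : ℝ :=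
  (prior k * marginal r α₁ α₂ X k y / ∑ l, prior l * marginal r α₁ α₂ X l y).toReal

end HyperPiMOM

namespace HyperPiMOM

/-! ### Quadratic forms and the residual sum of squares -/

/-! Put `z = n ^ η` with a small `η > 0`, and let `T` be the sum of the squared errors. Everything
happens on the event that each column of the design has inner product at most `√n z` with the errors
and that `T` lies between `σ₀² n / 2` and `2 σ₀² n`. By `measure_compl_good_le` its complement has
vanishing probability; the union bound runs over the `p n` columns only, never over the models. On
this event the argument is deterministic, and each marginal density is compared with `peak n T`.

True model (`exists_le_marginal_trueModel`): integrate over a box with `τ` between `√n` and `2√n`,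
`s` near `T / n` and `β` within `1 / √n` of the truth. The piMOM factor costs `exp (-O(τ))` and the
prior on `τ` costs `exp (-O(n / τ))`; at `τ ≍ √n` the two balance, so the total loss is at most `exp
(-C √n z)`.

A model that misses a true coefficient (`marginal_le_of_not_subset`): the residual sum of squares is
at least `T + n / z ^ 2` for every `β`, which lowers the likelihood by a factor `exp (-n / (2 z ^
3))`.

A model that strictly contains the true one (`marginal_le_of_ssubset`): the fit can lower the
residual by at most `2 |k| z ^ 3`, a gain of at most `exp (|k| z ^ 4)`. A superfluous coefficient
`b` is penalized by the likelihood if large and by the piMOM density if small; by the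
arithmetic-geometric inequality the product is at most `exp (-√(h τ))` with `h = n ε / 2`, whatever
`b` and `s` are. For `τ ≥ z ^ 8` this beats the gain and the loss of the true model, and for smaller
`τ` the prior on `τ` contributes `exp (-n / (4 z ^ 8))`.

Hence every wrong model of positive prior mass has marginal at most `exp (-z) ^ (|k| + 1)` times
that of the true one. Summed over all subsets this is at most `3 exp (-z)`, because `p n` grows
polynomially and so `p n * exp (-z) ≤ 1` eventually. -/

/-- A coefficient vector of the model `k`, extended by zero to all the columns. -/
noncomputable def extendZero {p : ℕ} (k : Finset (Fin p)) (β : k → ℝ) : Fin p → ℝ :=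
  fun i => if h : i ∈ k then β ⟨i, h⟩ else 0

theorem extendZero_of_mem {p : ℕ} {k : Finset (Fin p)} (β : k → ℝ) {i : Fin p} (h : i ∈ k) :
    extendZero k β i = β ⟨i, h⟩ := by
  simp [extendZero, h]

theorem extendZero_of_notMem {p : ℕ} {k : Finset (Fin p)} (β : k → ℝ) {i : Fin p} (h : i ∉ k) :
    extendZero k β i = 0 := by
  simp [extendZero, h]

theorem modelMatrix_mulVec {n p : ℕ} (X : Matrix (Fin n) (Fin p) ℝ) (k : Finset (Fin p))
    (β : k → ℝ) : modelMatrix X k *ᵥ β = X *ᵥ extendZero k β := by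
  ext i
  simp only [Matrix.mulVec, dotProduct, modelMatrix, Matrix.submatrix_apply, id]
  rw [← Finset.sum_subset (Finset.subset_univ k), ← Finset.sum_attach k, Finset.univ_eq_attach]
  · exact Finset.sum_congr rfl fun j _ => by rw [extendZero_of_mem β j.2]
  · intro j _ hj
    rw [extendZero_of_notMem β hj, mul_zero]

theorem dotProduct_mulVec_eq_sum_eigenvalues {ι : Type*} [Fintype ι] [DecidableEq ι]
    {A : Matrix ι ι ℝ} (hA : A.IsHermitian) (v : ι → ℝ) :
    v ⬝ᵥ (A *ᵥ v) = ∑ i, hA.eigenvalues i * (inner ℝ (hA.eigenvectorBasis i) (WithLp.toLp 2 v)) ^ 2 := by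
  have h1 := OrthonormalBasis.sum_inner_mul_inner hA.eigenvectorBasis (WithLp.toLp 2 v)
    (WithLp.toLp 2 (A *ᵥ v))
  have h2 : inner ℝ (WithLp.toLp 2 v) (WithLp.toLp 2 (A *ᵥ v)) = v ⬝ᵥ (A *ᵥ v) := by
    simp [EuclideanSpace.inner_eq_star_dotProduct, dotProduct_comm]
  rw [← h2, ← h1]
  refine Finset.sum_congr rfl fun i _ => ?_
  have h3 : inner ℝ (hA.eigenvectorBasis i) (WithLp.toLp 2 (A *ᵥ v)) =
      hA.eigenvalues i * inner ℝ (hA.eigenvectorBasis i) (WithLp.toLp 2 v) := by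
    have h4 : (A *ᵥ v) ⬝ᵥ (hA.eigenvectorBasis i).ofLp =
        hA.eigenvalues i * (v ⬝ᵥ (hA.eigenvectorBasis i).ofLp) := by
      have h5 : Aᵀ = A := by
        simpa [Matrix.conjTranspose_eq_transpose_of_trivial] using hA.eq
      rw [dotProduct_comm, Matrix.dotProduct_mulVec, ← Matrix.mulVec_transpose, h5,
        hA.mulVec_eigenvectorBasis, smul_dotProduct, dotProduct_comm, smul_eq_mul]
    simpa [EuclideanSpace.inner_eq_star_dotProduct] using h4
  rw [h3, real_inner_comm]
  ring

theorem quadratic_form_bounds {ι : Type*} [Fintype ι] [DecidableEq ι]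
    {A : Matrix ι ι ℝ} (hA : A.IsHermitian) {a b : ℝ}
    (h : ∀ i, a ≤ hA.eigenvalues i ∧ hA.eigenvalues i ≤ b) (v : ι → ℝ) :
    a * ∑ i, v i ^ 2 ≤ v ⬝ᵥ (A *ᵥ v) ∧ v ⬝ᵥ (A *ᵥ v) ≤ b * ∑ i, v i ^ 2 := by
  have h1 : ∑ i, (inner ℝ (hA.eigenvectorBasis i) (WithLp.toLp 2 v)) ^ 2 = ∑ i, v i ^ 2 := by
    have := hA.eigenvectorBasis.sum_sq_norm_inner_right (WithLp.toLp 2 v)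
    simpa [EuclideanSpace.norm_sq_eq] using this
  rw [dotProduct_mulVec_eq_sum_eigenvalues hA, ← h1, Finset.mul_sum, Finset.mul_sum]
  exact ⟨Finset.sum_le_sum fun i _ => mul_le_mul_of_nonneg_right (h i).1 (sq_nonneg _),
    Finset.sum_le_sum fun i _ => mul_le_mul_of_nonneg_right (h i).2 (sq_nonneg _)⟩

/-- When `K.card ≤ n` every eigenvalue of the Gram matrix is among those controlled by
`EigenvalueBounds`, so the quadratic form is bounded on both sides. -/
theorem EigenvalueBounds.sum_sq_mulVec {n p : ℕ} {X : Matrix (Fin n) (Fin p) ℝ} {ε : ℝ}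
    (hX : EigenvalueBounds X ε) (hn : 1 ≤ n) {K : Finset (Fin p)} (hK : K.card ≤ n)
    {θ : Fin p → ℝ} (hθ : ∀ i ∉ K, θ i = 0) :
    n * ε * ∑ i, θ i ^ 2 ≤ ∑ i, (X *ᵥ θ) i ^ 2 ∧
      ∑ i, (X *ᵥ θ) i ^ 2 ≤ n * ε⁻¹ * ∑ i, θ i ^ 2 := by
  have hn' : (0 : ℝ) < n := by exact_mod_cast hn
  let v : K → ℝ := fun i => θ i
  have hv : extendZero K v = θ := by
    ext i
    by_cases h : i ∈ K
    · rw [extendZero_of_mem v h]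
    · rw [extendZero_of_notMem v h, hθ i h]
  have h1 : ∑ i, θ i ^ 2 = ∑ i, v i ^ 2 := by
    rw [← Finset.sum_subset (Finset.subset_univ K), ← Finset.sum_attach K, Finset.univ_eq_attach]
    intro i _ hi
    simp [hθ i hi]
  have h2 : ∑ i, (X *ᵥ θ) i ^ 2 = n * (v ⬝ᵥ (gram X K *ᵥ v)) := by
    rw [gram, Matrix.smul_mulVec, dotProduct_smul, smul_eq_mul, ← mul_assoc,
      mul_one_div_cancel hn'.ne', one_mul, ← Matrix.mulVec_mulVec, Matrix.dotProduct_mulVec,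
      Matrix.vecMul_transpose, modelMatrix_mulVec, hv]
    simp [dotProduct, sq]
  have h3 := quadratic_form_bounds (gram_isHermitian X K) (a := ε) (b := ε⁻¹) (fun i =>
    hX K _ (lt_of_lt_of_le (Fin.is_lt _) (by simpa using hK))) v
  rw [h1, h2, mul_assoc, mul_assoc]
  exact ⟨mul_le_mul_of_nonneg_left h3.1 hn'.le, mul_le_mul_of_nonneg_left h3.2 hn'.le⟩

theorem EigenvalueBounds.sum_sq_column {n p : ℕ} {X : Matrix (Fin n) (Fin p) ℝ} {ε : ℝ}
    (hX : EigenvalueBounds X ε) (hn : 1 ≤ n) (j : Fin p) :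
    ∑ i, X i j ^ 2 ≤ n * ε⁻¹ := by
  have h := (hX.sum_sq_mulVec hn (K := {j}) (by simpa using hn) (θ := Pi.single j 1) (by
    intro i hi
    simp at hi
    simp [hi])).2
  simpa [Pi.single_apply, ite_pow] using h

theorem dotProduct_mulVec_le {n p : ℕ} {X : Matrix (Fin n) (Fin p) ℝ} {e : Fin n → ℝ} {M : ℝ}
    (hM : ∀ j, |∑ i, X i j * e i| ≤ M) (θ : Fin p → ℝ) :
    |∑ i, e i * (X *ᵥ θ) i| ≤ M * ∑ j, |θ j| := by
  have h : ∑ i, e i * (X *ᵥ θ) i = ∑ j, θ j * ∑ i, X i j * e i := by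
    simp only [Matrix.mulVec, dotProduct, Finset.mul_sum]
    rw [Finset.sum_comm]
    exact Finset.sum_congr rfl fun _ _ => Finset.sum_congr rfl fun _ _ => by ring
  rw [h, Finset.mul_sum]
  refine (Finset.abs_sum_le_sum_abs _ _).trans (Finset.sum_le_sum fun j _ => ?_)
  rw [abs_mul, mul_comm]
  exact mul_le_mul_of_nonneg_right (hM j) (abs_nonneg _)

theorem sum_sub_sq {n : ℕ} (e v : Fin n → ℝ) :
    ∑ i, (e i - v i) ^ 2 = ∑ i, e i ^ 2 - 2 * ∑ i, e i * v i + ∑ i, v i ^ 2 := by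
  rw [Finset.mul_sum, ← Finset.sum_sub_distrib, ← Finset.sum_add_distrib]
  exact Finset.sum_congr rfl fun _ _ => by ring

/-- The cross term is at most `2 M ‖θ‖₁`. Completing the square in each coordinate absorbs it into
half of the quadratic term `n ε ‖θ‖²`, at a cost of `2 M ^ 2 / (n ε)` per coordinate of `K`. The
other half is kept as a penalty on `θ`. -/
theorem le_residual {n p : ℕ} {X : Matrix (Fin n) (Fin p) ℝ} {ε : ℝ} (hε : 0 < ε)
    (hX : EigenvalueBounds X ε) (hn : 1 ≤ n) {K : Finset (Fin p)} (hK : K.card ≤ n)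
    {θ : Fin p → ℝ} (hθ : ∀ i ∉ K, θ i = 0) {e : Fin n → ℝ} {M : ℝ}
    (hM : ∀ j, |∑ i, X i j * e i| ≤ M) :
    ∑ i, e i ^ 2 - 2 * K.card * (M ^ 2 / (n * ε)) + n * ε / 2 * ∑ i, θ i ^ 2 ≤
      ∑ i, (e i - (X *ᵥ θ) i) ^ 2 := by
  have hn' : (0 : ℝ) < n := by exact_mod_cast hn
  have h1 := (hX.sum_sq_mulVec hn hK hθ).1
  have h2 := (abs_le.mp (dotProduct_mulVec_le hM θ)).2
  have hs : ∀ f : Fin p → ℝ, (∀ i ∉ K, f i = 0) → ∑ i, f i = ∑ i ∈ K, f i := fun f hf =>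
    (Finset.sum_subset (Finset.subset_univ K) fun i _ hi => hf i hi).symm
  have h3 : 2 * (M * ∑ j, |θ j|) ≤ 2 * K.card * (M ^ 2 / (n * ε)) + n * ε / 2 * ∑ i, θ i ^ 2 := by
    rw [hs (fun i => |θ i|) (fun i hi => by simp [hθ i hi]),
      hs (fun i => θ i ^ 2) (fun i hi => by simp [hθ i hi])]
    have : (2 : ℝ) * K.card * (M ^ 2 / (n * ε)) = ∑ _i ∈ K, 2 * (M ^ 2 / (n * ε)) := by
      rw [Finset.sum_const, nsmul_eq_mul]; ring
    rw [this, Finset.mul_sum, Finset.mul_sum, Finset.mul_sum, ← Finset.sum_add_distrib]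
    refine Finset.sum_le_sum fun i _ => ?_
    have hc : 0 < n * ε := mul_pos hn' hε
    have h4 : 2 * (M ^ 2 / (n * ε)) + n * ε / 2 * θ i ^ 2 - 2 * (M * |θ i|) =
        (2 * M - n * ε * |θ i|) ^ 2 / (2 * (n * ε)) := by
      rw [← sq_abs (θ i)]
      field_simp
      ring
    have h5 : 0 ≤ (2 * M - n * ε * |θ i|) ^ 2 / (2 * (n * ε)) := by positivity
    linarith
  rw [sum_sub_sq]
  linarith

theorem residual_le {n p : ℕ} {X : Matrix (Fin n) (Fin p) ℝ} {ε : ℝ}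
    (hX : EigenvalueBounds X ε) (hn : 1 ≤ n) {K : Finset (Fin p)} (hK : K.card ≤ n)
    {θ : Fin p → ℝ} (hθ : ∀ i ∉ K, θ i = 0) {e : Fin n → ℝ} {M : ℝ}
    (hM : ∀ j, |∑ i, X i j * e i| ≤ M) :
    ∑ i, (e i - (X *ᵥ θ) i) ^ 2 ≤
      ∑ i, e i ^ 2 + 2 * M * ∑ j, |θ j| + n * ε⁻¹ * ∑ i, θ i ^ 2 := by
  have h1 := (hX.sum_sq_mulVec hn hK hθ).2
  have h2 := (abs_le.mp (dotProduct_mulVec_le hM θ)).1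
  rw [sum_sub_sq]
  linarith

/-! ### The prior densities and bounds on the marginal density -/

/-- Substitution `u = x ^ (-m)` in the Gamma integral. The case `m = 1` normalizes the inverse gamma
density, `m = 2` the piMOM density. -/
theorem integral_rpow_mul_exp_neg_rpow {m a b : ℝ} (hm : 0 < m) (ha : 0 < a) (hb : 0 < b) :
    ∫ x in Set.Ioi (0 : ℝ), x ^ (-(m * a + 1)) * Real.exp (-b * x ^ (-m)) =
      Real.Gamma a * b ^ (-a) / m := by
  have h1 := integral_comp_rpow_Ioi (fun u : ℝ => u ^ (a - 1) * Real.exp (-(b * u)))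
    (p := -m) (by linarith)
  rw [Real.integral_rpow_mul_exp_neg_mul_Ioi ha hb] at h1
  have h2 : ∫ x in Set.Ioi (0 : ℝ), (|-m| * x ^ (-m - 1)) •
      ((x ^ (-m)) ^ (a - 1) * Real.exp (-(b * x ^ (-m)))) =
      m * ∫ x in Set.Ioi (0 : ℝ), x ^ (-(m * a + 1)) * Real.exp (-b * x ^ (-m)) := by
    rw [← integral_const_mul]
    refine setIntegral_congr_fun measurableSet_Ioi fun x hx => ?_
    have hx' : (0 : ℝ) < x := hx
    have h3 : x ^ (-(m * a + 1)) = x ^ (-m - 1) * (x ^ (-m)) ^ (a - 1) := by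
      rw [← Real.rpow_mul hx'.le, ← Real.rpow_add hx']
      ring_nf
    simp only [abs_neg, abs_of_pos hm, smul_eq_mul, h3, neg_mul]
    ring
  rw [h2] at h1
  rw [eq_div_iff hm.ne', mul_comm, h1, one_div, Real.inv_rpow hb.le, Real.rpow_neg hb.le]
  ring

theorem invGamma_nonneg {a b x : ℝ} (ha : 0 < a) (hb : 0 < b) (hx : 0 < x) :
    0 ≤ invGamma a b x := by
  have := Real.Gamma_pos_of_pos ha
  unfold invGamma
  positivity

theorem lintegral_invGamma {a b : ℝ} (ha : 0 < a) (hb : 0 < b) :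
    ∫⁻ x in Set.Ioi (0 : ℝ), ENNReal.ofReal (invGamma a b x) = 1 := by
  have hG := Real.Gamma_pos_of_pos ha
  have h1 : ∫ x in Set.Ioi (0 : ℝ), invGamma a b x = 1 := by
    have h2 := integral_rpow_mul_exp_neg_rpow one_pos ha hb
    have h3 : ∫ x in Set.Ioi (0 : ℝ), invGamma a b x = b ^ a / Real.Gamma a *
        ∫ x in Set.Ioi (0 : ℝ), x ^ (-(1 * a + 1)) * Real.exp (-b * x ^ (-(1 : ℝ))) := by
      rw [← integral_const_mul]
      refine setIntegral_congr_fun measurableSet_Ioi fun x hx => ?_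
      simp only [invGamma, one_mul, Real.rpow_neg_one, div_eq_mul_inv]
      ring
    rw [h3, h2, div_one, Real.rpow_neg hb.le]
    have := Real.rpow_pos_of_pos hb a
    field_simp
  -- Integrability comes for free: the Bochner integral of a non-integrable function would be `0`,
  -- not `1`.
  rw [← ofReal_integral_eq_lintegral_ofReal
    (Integrable.of_integral_ne_zero (by rw [h1]; exact one_ne_zero)), h1, ENNReal.ofReal_one]
  exact (ae_restrict_mem measurableSet_Ioi).mono fun x hx => invGamma_nonneg ha hb hx

theorem piMOM_nonneg {ι : Type*} [Fintype ι] {r : ℕ} (hr : 1 ≤ r) {τ s : ℝ} (hτ : 0 < τ)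
    (hs : 0 < s) (β : ι → ℝ) : 0 ≤ piMOM r τ s β := by
  have hr' : (0 : ℝ) < r := by exact_mod_cast hr
  have := Real.Gamma_pos_of_pos (half_pos hr')
  exact Finset.prod_nonneg fun i _ => by positivity

theorem integral_piMOM_factor {r : ℕ} (hr : 1 ≤ r) {c : ℝ} (hc : 0 < c) :
    ∫ b : ℝ, c ^ ((r : ℝ) / 2) / Real.Gamma ((r : ℝ) / 2) * (|b| ^ (r + 1))⁻¹ *
      Real.exp (-c / b ^ 2) = 1 := by
  have hr' : (0 : ℝ) < r := by exact_mod_cast hr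
  have hG := Real.Gamma_pos_of_pos (half_pos hr')
  have h1 := integral_rpow_mul_exp_neg_rpow two_pos (half_pos hr') hc
  have h2 := integral_comp_abs (f := fun b : ℝ => c ^ ((r : ℝ) / 2) / Real.Gamma ((r : ℝ) / 2) *
    (b ^ (r + 1))⁻¹ * Real.exp (-c / b ^ 2))
  simp only [sq_abs] at h2
  have h3 : ∫ x in Set.Ioi (0 : ℝ), c ^ ((r : ℝ) / 2) / Real.Gamma ((r : ℝ) / 2) *
    (x ^ (r + 1))⁻¹ * Real.exp (-c / x ^ 2) = c ^ ((r : ℝ) / 2) / Real.Gamma ((r : ℝ) / 2) *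
      ∫ x in Set.Ioi (0 : ℝ), x ^ (-(2 * ((r : ℝ) / 2) + 1)) * Real.exp (-c * x ^ (-(2 : ℝ))) := by
    rw [← integral_const_mul]
    refine setIntegral_congr_fun measurableSet_Ioi fun x hx => ?_
    have hx' : (0 : ℝ) < x := hx
    have h4 : x ^ (-(2 * ((r : ℝ) / 2) + 1)) = (x ^ (r + 1))⁻¹ := by
      rw [mul_div_cancel₀ _ two_ne_zero, Real.rpow_neg hx'.le, ← Real.rpow_natCast]
      push_cast
      rfl
    have h5 : x ^ (-(2 : ℝ)) = (x ^ 2)⁻¹ := by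
      rw [Real.rpow_neg hx'.le, Real.rpow_two]
    rw [h4, h5, div_eq_mul_inv (-c)]
    ring
  rw [h2, h3, h1, Real.rpow_neg hc.le]
  have := Real.rpow_pos_of_pos hc ((r : ℝ) / 2)
  field_simp

theorem lintegral_piMOM {ι : Type*} [Fintype ι] {r : ℕ} (hr : 1 ≤ r) {τ s : ℝ} (hτ : 0 < τ)
    (hs : 0 < s) : ∫⁻ β : ι → ℝ, ENNReal.ofReal (piMOM r τ s β) = 1 := by
  have h1 : ∫ β : ι → ℝ, piMOM r τ s β = 1 := by
    have := integral_fintype_prod_volume_eq_prod (ι := ι) (E := fun _ => ℝ) (𝕜 := ℝ)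
      (fun _ b => (τ * s) ^ ((r : ℝ) / 2) / Real.Gamma ((r : ℝ) / 2) *
        (|b| ^ (r + 1))⁻¹ * Real.exp (-(τ * s) / b ^ 2))
    simp only [integral_piMOM_factor hr (mul_pos hτ hs), Finset.prod_const_one] at this
    exact this
  rw [← ofReal_integral_eq_lintegral_ofReal
    (Integrable.of_integral_ne_zero (by rw [h1]; exact one_ne_zero)), h1, ENNReal.ofReal_one]
  exact ae_of_all _ fun β => piMOM_nonneg hr hτ hs β

/-- The largest value over `s > 0` of `(2πs)^(-n/2) exp (-R / (2s))`. -/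
noncomputable def peak (n : ℕ) (R : ℝ) : ℝ :=
  (2 * Real.pi * (R / n)) ^ (-((n : ℝ) / 2)) * Real.exp (-((n : ℝ) / 2))

theorem peak_pos {n : ℕ} (hn : 1 ≤ n) {R : ℝ} (hR : 0 < R) : 0 < peak n R := by
  have hn' : (0 : ℝ) < n := by exact_mod_cast hn
  have := Real.pi_pos
  unfold peak
  positivity

theorem peak_eq_exp {n : ℕ} (hn : 1 ≤ n) {R : ℝ} (hR : 0 < R) :
    peak n R = Real.exp (-((n : ℝ) / 2) * (Real.log (2 * Real.pi) + Real.log (R / n) + 1)) := by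
  have hn' : (0 : ℝ) < n := by exact_mod_cast hn
  have := Real.pi_pos
  rw [peak, Real.rpow_def_of_pos (by positivity), ← Real.exp_add,
    Real.log_mul (by positivity) (by positivity)]
  ring_nf

theorem rpow_mul_exp_le_peak {n : ℕ} (hn : 1 ≤ n) {R s : ℝ} (hR : 0 < R) (hs : 0 < s) :
    (2 * Real.pi * s) ^ (-((n : ℝ) / 2)) * Real.exp (-R / (2 * s)) ≤ peak n R := by
  have hn' : (0 : ℝ) < n := by exact_mod_cast hn
  have := Real.pi_pos
  rw [peak_eq_exp hn hR, Real.rpow_def_of_pos (by positivity), ← Real.exp_add, Real.exp_le_exp,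
    Real.log_mul (by positivity) hs.ne']
  have h1 := Real.log_le_sub_one_of_pos (show 0 < R / n / s by positivity)
  rw [Real.log_div (by positivity) hs.ne'] at h1
  have h2 : -R / (2 * s) = -((n : ℝ) / 2) * (R / n / s) := by
    field_simp
  rw [h2]
  nlinarith [h1, hn']

/-- Since `peak n R` is proportional to `R ^ (-n / 2)`, this is `log (T / R) ≤ T / R - 1`. -/
theorem peak_le_peak_mul_exp {n : ℕ} (hn : 1 ≤ n) {R T : ℝ} (hR : 0 < R) (hT : 0 < T) :
    peak n R ≤ peak n T * Real.exp ((n : ℝ) / 2 * (T / R - 1)) := by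
  have hn' : (0 : ℝ) < n := by exact_mod_cast hn
  rw [peak_eq_exp hn hR, peak_eq_exp hn hT, ← Real.exp_add, Real.exp_le_exp]
  have h1 := Real.log_le_sub_one_of_pos (show 0 < T / R by positivity)
  rw [Real.log_div hT.ne' hR.ne'] at h1
  rw [Real.log_div hR.ne' hn'.ne', Real.log_div hT.ne' hn'.ne']
  nlinarith [h1, hn']

/-- The arithmetic-geometric inequality behind the penalty on a superfluous coefficient. -/
theorem exp_mul_exp_le {h τ s b : ℝ} (hh : 0 ≤ h) (hτ : 0 < τ) (hs : 0 < s) (hb : b ≠ 0) :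
    Real.exp (-(h * b ^ 2) / (2 * s)) * Real.exp (-(τ * s) / b ^ 2) ≤
      Real.exp (-√(h * τ)) * Real.exp (-(τ / 2 * s) / b ^ 2) := by
  rw [← Real.exp_add, ← Real.exp_add, Real.exp_le_exp]
  have hb2 : 0 < b ^ 2 := by positivity
  -- The product of the two terms on the right is `h τ / 4`, free of `b` and `s`. Only half of the
  -- piMOM exponent is spent; the other half leaves a piMOM density of scale `τ / 2`, which still
  -- integrates to one.
  have h1 : √(h * τ) ≤ h * b ^ 2 / (2 * s) + τ * s / 2 / b ^ 2 := by
    refine Real.sqrt_le_iff.mpr ⟨by positivity, ?_⟩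
    have : h * τ = 4 * (h * b ^ 2 / (2 * s)) * (τ * s / 2 / b ^ 2) := by
      field_simp
      ring
    rw [this]
    nlinarith [sq_nonneg (h * b ^ 2 / (2 * s) - τ * s / 2 / b ^ 2)]
  have h2 : -(h * b ^ 2) / (2 * s) = -(h * b ^ 2 / (2 * s)) := by ring
  have h3 : -(τ * s) / b ^ 2 = -(τ * s / 2 / b ^ 2) + -(τ / 2 * s) / b ^ 2 := by ring
  rw [h2, h3]
  linarith

theorem exp_mul_piMOM_le {ι : Type*} [Fintype ι] {r : ℕ} (hr : 1 ≤ r) {h τ s : ℝ}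
    (hh : 0 ≤ h) (hτ : 0 < τ) (hs : 0 < s) (J : Finset ι) (β : ι → ℝ) :
    Real.exp (-(h * ∑ i ∈ J, β i ^ 2) / (2 * s)) * piMOM r τ s β ≤
      2 ^ ((r : ℝ) * Fintype.card ι / 2) * Real.exp (-(J.card * √(h * τ))) *
        piMOM r (τ / 2) s β := by
  classical
  have hr' : (0 : ℝ) < r := by exact_mod_cast hr
  have hG := Real.Gamma_pos_of_pos (half_pos hr')
  have e1 : Real.exp (-(h * ∑ i ∈ J, β i ^ 2) / (2 * s)) =
      ∏ i, if i ∈ J then Real.exp (-(h * β i ^ 2) / (2 * s)) else 1 := by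
    rw [Finset.prod_ite_mem, Finset.univ_inter, ← Real.exp_sum, Finset.mul_sum,
      ← Finset.sum_neg_distrib, Finset.sum_div]
  have e2 : Real.exp (-(J.card * √(h * τ))) =
      ∏ i, if i ∈ J then Real.exp (-√(h * τ)) else 1 := by
    rw [Finset.prod_ite_mem, Finset.univ_inter, Finset.prod_const, ← Real.exp_nat_mul, mul_neg]
  have e3 : (2 : ℝ) ^ ((r : ℝ) * Fintype.card ι / 2) = ∏ _i : ι, (2 : ℝ) ^ ((r : ℝ) / 2) := by
    rw [Finset.prod_const, ← Real.rpow_natCast, ← Real.rpow_mul two_pos.le, Finset.card_univ]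
    ring_nf
  rw [e1, e2, e3, piMOM, piMOM, ← Finset.prod_mul_distrib, ← Finset.prod_mul_distrib,
    ← Finset.prod_mul_distrib]
  refine Finset.prod_le_prod (fun i _ => by split_ifs <;> positivity) fun i _ => ?_
  -- At zero both factors vanish, because the inverse of `0 ^ (r + 1)` is `0`.
  by_cases hb : β i = 0
  · simp [hb]
  have e4 : (2 : ℝ) ^ ((r : ℝ) / 2) * (τ / 2 * s) ^ ((r : ℝ) / 2) = (τ * s) ^ ((r : ℝ) / 2) := by
    rw [← Real.mul_rpow two_pos.le (by positivity)]
    ring_nf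
  rw [← e4]
  have hA : 0 ≤ (2 : ℝ) ^ ((r : ℝ) / 2) * (τ / 2 * s) ^ ((r : ℝ) / 2) / Real.Gamma ((r : ℝ) / 2) *
      (|β i| ^ (r + 1))⁻¹ := by positivity
  split_ifs
  · have := mul_le_mul_of_nonneg_left (exp_mul_exp_le hh hτ hs hb) hA
    calc _ = _ := by ring
      _ ≤ _ := this
      _ = _ := by ring
  · have h5 : Real.exp (-(τ * s) / β i ^ 2) ≤ Real.exp (-(τ / 2 * s) / β i ^ 2) := by
      rw [Real.exp_le_exp]
      have : 0 < τ * s := mul_pos hτ hs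
      gcongr
      linarith
    have := mul_le_mul_of_nonneg_left h5 hA
    calc _ = _ := by ring
      _ ≤ _ := this
      _ = _ := by ring

/-- Split at `τ₀`: above it the factor `exp (-A √τ)` is small, below it half of the exponent of the
prior is. The other half leaves an inverse gamma density of scale `b / 2`, and `√2` is the ratio of
the normalizing constants. -/
theorem exp_mul_invGamma_le {A b τ₀ τ : ℝ} (hA : 0 ≤ A) (hb : 0 < b) (hτ : 0 < τ) :
    Real.exp (-(A * √τ)) * invGamma (1 / 2) b τ ≤
      √2 * Real.exp (-min (A * √τ₀) (b / (2 * τ₀))) * invGamma (1 / 2) (b / 2) τ := by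
  have hG := Real.Gamma_pos_of_pos (half_pos (one_pos (α := ℝ)))
  have e1 : b ^ (1 / 2 : ℝ) = √2 * (b / 2) ^ (1 / 2 : ℝ) := by
    rw [Real.sqrt_eq_rpow, ← Real.mul_rpow two_pos.le (by positivity)]
    ring_nf
  have h1 : Real.exp (-(A * √τ)) * Real.exp (-b / τ) ≤
      Real.exp (-min (A * √τ₀) (b / (2 * τ₀))) * Real.exp (-(b / 2) / τ) := by
    rw [← Real.exp_add, ← Real.exp_add, Real.exp_le_exp]
    have h2 : -b / τ = -(b / (2 * τ)) + -(b / 2) / τ := by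
      field_simp
      ring
    have h3 : 0 ≤ b / (2 * τ) := by positivity
    have h4 : 0 ≤ A * √τ := by positivity
    rw [h2]
    rcases le_total τ₀ τ with h | h
    · have : A * √τ₀ ≤ A * √τ := mul_le_mul_of_nonneg_left (Real.sqrt_le_sqrt h) hA
      have := min_le_left (A * √τ₀) (b / (2 * τ₀))
      linarith
    · have : b / (2 * τ₀) ≤ b / (2 * τ) := by gcongr
      have := min_le_right (A * √τ₀) (b / (2 * τ₀))
      linarith
  have hC : 0 ≤ √2 * (b / 2) ^ (1 / 2 : ℝ) / Real.Gamma (1 / 2) * τ ^ (-((1 / 2 : ℝ) + 1)) := by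
    positivity
  have := mul_le_mul_of_nonneg_left h1 hC
  unfold invGamma
  rw [e1]
  calc _ = _ := by ring
      _ ≤ _ := this
      _ = _ := by ring

/-- The integrand is dominated by a constant times a product of probability densities, with `τ` and
the piMOM scale halved, so the constant bounds the integral. `J` holds the coefficients to be
penalized and `τ₀` is free; `J = ∅`, `h = 0` gives the bound by the likelihood alone. -/
theorem marginal_le {n p r : ℕ} (hn : 1 ≤ n) (hr : 1 ≤ r) {α₁ α₂ : ℝ} (hα₁ : 0 < α₁)
    (hα₂ : 0 < α₂) {X : Matrix (Fin n) (Fin p) ℝ} {k : Finset (Fin p)} {y : Fin n → ℝ} {R h : ℝ}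
    (hR : 0 < R) (hh : 0 ≤ h) (J : Finset k) (τ₀ : ℝ)
    (hy : ∀ β : k → ℝ, R + h * ∑ i ∈ J, β i ^ 2 ≤ ∑ i, (y i - (modelMatrix X k *ᵥ β) i) ^ 2) :
    marginal r α₁ α₂ X k y ≤ ENNReal.ofReal (peak n R * 2 ^ ((r : ℝ) * k.card / 2) * √2 *
      Real.exp (-min (J.card * √h * √τ₀) ((n : ℝ) / (4 * τ₀)))) := by
  have hn' : (0 : ℝ) < n := by exact_mod_cast hn
  have hpeak := peak_pos hn hR
  set C : ℝ := peak n R * 2 ^ ((r : ℝ) * k.card / 2) * √2 *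
      Real.exp (-min (J.card * √h * √τ₀) ((n : ℝ) / (4 * τ₀))) with hCdef
  have hC : 0 ≤ C := by positivity
  have hpt : ∀ τ ∈ Set.Ioi (0 : ℝ), ∀ s ∈ Set.Ioi (0 : ℝ), ∀ β : k → ℝ,
      likelihood X k s β y * piMOM r τ s β * invGamma (1 / 2) ((n : ℝ) / 2) τ *
        invGamma α₁ α₂ s ≤
      C * invGamma (1 / 2) ((n : ℝ) / 2 / 2) τ * invGamma α₁ α₂ s * piMOM r (τ / 2) s β := by
    intro τ hτ s hs β
    have hτ' : (0 : ℝ) < τ := hτ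
    have hs' : (0 : ℝ) < s := hs
    have i1 := invGamma_nonneg (a := 1 / 2) (by norm_num) (half_pos hn') hτ'
    have i2 := invGamma_nonneg hα₁ hα₂ hs'
    have i3 := piMOM_nonneg hr hτ' hs' β
    have i4 := piMOM_nonneg hr (half_pos hτ') hs' β
    have h1 : likelihood X k s β y ≤
        peak n R * Real.exp (-(h * ∑ i ∈ J, β i ^ 2) / (2 * s)) := by
      refine le_trans ?_ (mul_le_mul_of_nonneg_right (rpow_mul_exp_le_peak hn hR hs')
        (Real.exp_nonneg _))
      rw [likelihood, mul_assoc _ (Real.exp _), ← Real.exp_add]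
      refine mul_le_mul_of_nonneg_left (Real.exp_le_exp.mpr ?_)
        (Real.rpow_nonneg (by positivity) _)
      rw [← add_div]
      have := hy β
      gcongr
      linarith
    have h2 := exp_mul_piMOM_le hr hh hτ' hs' J β
    have h3 := exp_mul_invGamma_le (A := J.card * √h) (τ₀ := τ₀) (by positivity) (half_pos hn') hτ'
    rw [show (n : ℝ) / 2 / (2 * τ₀) = (n : ℝ) / (4 * τ₀) by rw [div_div]; ring_nf] at h3
    rw [Fintype.card_coe, Real.sqrt_mul hh, ← mul_assoc] at h2
    calc _ ≤ (peak n R * Real.exp (-(h * ∑ i ∈ J, β i ^ 2) / (2 * s))) * piMOM r τ s β *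
          invGamma (1 / 2) ((n : ℝ) / 2) τ * invGamma α₁ α₂ s := by gcongr
      _ = peak n R * (Real.exp (-(h * ∑ i ∈ J, β i ^ 2) / (2 * s)) * piMOM r τ s β) *
          invGamma (1 / 2) ((n : ℝ) / 2) τ * invGamma α₁ α₂ s := by ring
      _ ≤ peak n R * (2 ^ ((r : ℝ) * k.card / 2) * Real.exp (-(J.card * √h * √τ)) *
          piMOM r (τ / 2) s β) * invGamma (1 / 2) ((n : ℝ) / 2) τ * invGamma α₁ α₂ s := by gcongr
      _ = peak n R * 2 ^ ((r : ℝ) * k.card / 2) * piMOM r (τ / 2) s β * invGamma α₁ α₂ s *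
          (Real.exp (-(J.card * √h * √τ)) * invGamma (1 / 2) ((n : ℝ) / 2) τ) := by ring
      _ ≤ peak n R * 2 ^ ((r : ℝ) * k.card / 2) * piMOM r (τ / 2) s β * invGamma α₁ α₂ s *
          _ := mul_le_mul_of_nonneg_left h3 (by positivity)
      _ = _ := by rw [hCdef]; ring
  calc marginal r α₁ α₂ X k y
      ≤ ∫⁻ τ in Set.Ioi (0 : ℝ), ∫⁻ s in Set.Ioi (0 : ℝ), ∫⁻ β : k → ℝ,
        ENNReal.ofReal (C * invGamma (1 / 2) ((n : ℝ) / 2 / 2) τ * invGamma α₁ α₂ s) *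
          ENNReal.ofReal (piMOM r (τ / 2) s β) := by
        refine setLIntegral_mono' measurableSet_Ioi fun τ hτ =>
          setLIntegral_mono' measurableSet_Ioi fun s hs => lintegral_mono fun β => ?_
        rw [← ENNReal.ofReal_mul']
        · exact ENNReal.ofReal_le_ofReal (hpt τ hτ s hs β)
        · exact piMOM_nonneg hr (half_pos hτ) hs β
    _ = ∫⁻ τ in Set.Ioi (0 : ℝ), ∫⁻ s in Set.Ioi (0 : ℝ),
        ENNReal.ofReal (C * invGamma (1 / 2) ((n : ℝ) / 2 / 2) τ) *
          ENNReal.ofReal (invGamma α₁ α₂ s) := by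
        refine setLIntegral_congr_fun measurableSet_Ioi fun τ hτ =>
          setLIntegral_congr_fun measurableSet_Ioi fun s hs => ?_
        rw [lintegral_const_mul' _ _ ENNReal.ofReal_ne_top,
          lintegral_piMOM hr (half_pos hτ) hs, mul_one,
          ← ENNReal.ofReal_mul' (invGamma_nonneg hα₁ hα₂ hs)]
    _ = ∫⁻ τ in Set.Ioi (0 : ℝ), ENNReal.ofReal C *
          ENNReal.ofReal (invGamma (1 / 2) ((n : ℝ) / 2 / 2) τ) := by
        refine setLIntegral_congr_fun measurableSet_Ioi fun τ hτ => ?_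
        rw [lintegral_const_mul' _ _ ENNReal.ofReal_ne_top, lintegral_invGamma hα₁ hα₂, mul_one,
          ← ENNReal.ofReal_mul hC]
    _ = ENNReal.ofReal C := by
        rw [lintegral_const_mul' _ _ ENNReal.ofReal_ne_top,
          lintegral_invGamma (by norm_num) (half_pos (half_pos hn')), mul_one]


/-! ### The lower bound on the marginal density of the true model -/

theorem le_marginal {n p r : ℕ} {α₁ α₂ : ℝ} {X : Matrix (Fin n) (Fin p) ℝ} {k : Finset (Fin p)}
    {y : Fin n → ℝ} {a b c d v : ℝ} (ha : 0 < a) (hc : 0 < c) (hab : a ≤ b)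
    (hv : 0 ≤ v) (lo hi : k → ℝ)
    (h : ∀ τ ∈ Set.Icc a b, ∀ s ∈ Set.Icc c d, ∀ β ∈ Set.Icc lo hi,
      v ≤ likelihood X k s β y * piMOM r τ s β * invGamma (1 / 2) ((n : ℝ) / 2) τ *
        invGamma α₁ α₂ s) :
    ENNReal.ofReal (v * (b - a) * (d - c)) * ∏ i, ENNReal.ofReal (hi i - lo i) ≤
      marginal r α₁ α₂ X k y := by
  have h1 : ∀ τ ∈ Set.Icc a b, ∀ s ∈ Set.Icc c d,
      ENNReal.ofReal v * ∏ i, ENNReal.ofReal (hi i - lo i) ≤ ∫⁻ β : k → ℝ,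
        ENNReal.ofReal (likelihood X k s β y * piMOM r τ s β *
          invGamma (1 / 2) ((n : ℝ) / 2) τ * invGamma α₁ α₂ s) := by
    intro τ hτ s hs
    rw [← Real.volume_Icc_pi, ← setLIntegral_const]
    exact (setLIntegral_mono' measurableSet_Icc fun β hβ =>
      ENNReal.ofReal_le_ofReal (h τ hτ s hs β hβ)).trans (setLIntegral_le_lintegral _ _)
  have h2 : ∀ τ ∈ Set.Icc a b,
      ENNReal.ofReal v * (∏ i, ENNReal.ofReal (hi i - lo i)) * ENNReal.ofReal (d - c) ≤
        ∫⁻ s in Set.Ioi (0 : ℝ), ∫⁻ β : k → ℝ,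
          ENNReal.ofReal (likelihood X k s β y * piMOM r τ s β *
            invGamma (1 / 2) ((n : ℝ) / 2) τ * invGamma α₁ α₂ s) := by
    intro τ hτ
    rw [← Real.volume_Icc, ← setLIntegral_const]
    exact (setLIntegral_mono' measurableSet_Icc fun s hs => h1 τ hτ s hs).trans
      (lintegral_mono_set fun s hs => hc.trans_le hs.1)
  have h3 : ENNReal.ofReal v * (∏ i, ENNReal.ofReal (hi i - lo i)) * ENNReal.ofReal (d - c) *
      ENNReal.ofReal (b - a) ≤ marginal r α₁ α₂ X k y := by
    rw [← Real.volume_Icc (a := a), ← setLIntegral_const]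
    exact (setLIntegral_mono' measurableSet_Icc fun τ hτ => h2 τ hτ).trans
      (lintegral_mono_set fun s hs => ha.trans_le hs.1)
  refine le_of_eq_of_le ?_ h3
  rw [ENNReal.ofReal_mul (mul_nonneg hv (sub_nonneg.mpr hab)), ENNReal.ofReal_mul hv]
  ring

/-- Lets fixed constants be absorbed into exponentials of order `√n`. -/
theorem exp_neg_abs_log_mul_le {c H : ℝ} (hc : 0 < c) (hH : 1 ≤ H) :
    Real.exp (-(|Real.log c| * H)) ≤ c := by
  conv_rhs => rw [← Real.exp_log hc]
  rw [Real.exp_le_exp]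
  have h1 := neg_abs_le (Real.log c)
  have h2 := abs_nonneg (Real.log c)
  nlinarith

/-- The maximizing variance is `T / n`. A relative increase of at most `1 / n` costs at most a
factor `exp (-1 / 2)` in the power of `s`. -/
theorem le_likelihood {n p : ℕ} (hn : 1 ≤ n) {X : Matrix (Fin n) (Fin p) ℝ}
    {k : Finset (Fin p)} {y : Fin n → ℝ} {β : k → ℝ} {T Δ s : ℝ} (hT : 0 < T) (hΔ : 0 ≤ Δ)
    (hs : s ∈ Set.Icc (T / n) ((1 + 1 / n) * (T / n)))
    (hy : ∑ i, (y i - (modelMatrix X k *ᵥ β) i) ^ 2 ≤ T + Δ) :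
    peak n T * Real.exp (-(1 / 2 + Δ / (2 * (T / n)))) ≤ likelihood X k s β y := by
  have hn' : (0 : ℝ) < n := by exact_mod_cast hn
  have hS : 0 < T / n := by positivity
  have hs' : 0 < s := hS.trans_le hs.1
  have hpi := Real.pi_pos
  rw [likelihood, peak_eq_exp hn hT, Real.rpow_def_of_pos (by positivity), ← Real.exp_add,
    ← Real.exp_add, Real.exp_le_exp, Real.log_mul (by positivity) hs'.ne']
  have h1 : Real.log s ≤ Real.log (T / n) + 1 / n := by
    have h2 := Real.log_le_log hs' hs.2
    rw [Real.log_mul (by positivity) hS.ne'] at h2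
    have h3 := Real.log_le_sub_one_of_pos (show (0 : ℝ) < 1 + 1 / n by positivity)
    linarith
  have h4 : (∑ i, (y i - (modelMatrix X k *ᵥ β) i) ^ 2) / (2 * s) ≤
      n / 2 + Δ / (2 * (T / n)) := by
    calc _ ≤ (T + Δ) / (2 * s) := by gcongr
      _ ≤ (T + Δ) / (2 * (T / n)) := by
        gcongr
        exact hs.1
      _ = n / 2 + Δ / (2 * (T / n)) := by
        field_simp
  have h5 : (n : ℝ) / 2 * Real.log s ≤ n / 2 * Real.log (T / n) + 1 / 2 := by
    have := mul_le_mul_of_nonneg_left h1 (half_pos hn').le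
    have h6 : (n : ℝ) / 2 * (Real.log (T / n) + 1 / n) = n / 2 * Real.log (T / n) + 1 / 2 := by
      field_simp
    linarith
  rw [neg_div]
  linarith

theorem le_piMOM {ι : Type*} [Fintype ι] {r : ℕ} (hr : 1 ≤ r) {a b B c τ s : ℝ} (ha : 0 < a)
    (hb : 0 < b) {β : ι → ℝ} (h1 : a ≤ τ * s) (h2 : τ * s ≤ c) (hβ : ∀ i, b ≤ |β i| ∧ |β i| ≤ B) :
    (a ^ ((r : ℝ) / 2) / Real.Gamma ((r : ℝ) / 2) * (B ^ (r + 1))⁻¹ * Real.exp (-(c / b ^ 2))) ^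
      Fintype.card ι ≤ piMOM r τ s β := by
  have hr' : (0 : ℝ) < r := by exact_mod_cast hr
  have hG := Real.Gamma_pos_of_pos (half_pos hr')
  rw [piMOM, ← Finset.card_univ, ← Finset.prod_const]
  refine Finset.prod_le_prod (fun i _ => ?_) fun i _ => ?_
  · have := hb.trans_le ((hβ i).1.trans (hβ i).2)
    positivity
  · obtain ⟨hi, hi'⟩ := hβ i
    have hi0 : 0 < |β i| := hb.trans_le hi
    have h3 : b ^ 2 ≤ β i ^ 2 := by
      rw [← sq_abs (β i)]
      gcongr
    have hB0 : 0 < B := hi0.trans_le hi'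
    have hτs : 0 < τ * s := ha.trans_le h1
    have hc0 : 0 < c := hτs.trans_le h2
    have h4 : Real.exp (-(c / b ^ 2)) ≤ Real.exp (-(τ * s) / β i ^ 2) := by
      rw [Real.exp_le_exp, neg_div, neg_le_neg_iff]
      gcongr
    gcongr

theorem exists_pos_le_of_pos {ι : Type*} (s : Finset ι) (f : ι → ℝ) (hf : ∀ i ∈ s, 0 < f i) :
    ∃ b > 0, ∀ i ∈ s, b ≤ f i := by
  rcases s.eq_empty_or_nonempty with rfl | hs
  -- The empty case is needed: the true model may have no coefficient.
  · exact ⟨1, one_pos, by simp⟩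
  · obtain ⟨i, hi, h⟩ := s.exists_min_image f hs
    exact ⟨f i, hf i hi, h⟩

theorem mem_trueModel {p : ℕ} {β₀ : ℕ →₀ ℝ} {i : Fin p} :
    i ∈ trueModel p β₀ ↔ (i : ℕ) ∈ β₀.support := by
  simp [trueModel]

theorem card_trueModel_le (p : ℕ) (β₀ : ℕ →₀ ℝ) : (trueModel p β₀).card ≤ β₀.support.card :=
  Finset.card_le_card_of_injOn (fun i => (i : ℕ)) (fun _ hi => mem_trueModel.mp hi)
    (Fin.val_injective.injOn)

/-- At distance `1 / √n` per coordinate, the cross term with the errors contributes at most `2 d z`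
and the quadratic term at most `d z`. -/
theorem residual_trueModel_le {n p : ℕ} (hn : 1 ≤ n) {X : Matrix (Fin n) (Fin p) ℝ}
    {β₀ : ℕ →₀ ℝ} {ε z d : ℝ} (hε : 0 ≤ ε⁻¹) (hX : EigenvalueBounds X ε) (hεz : ε⁻¹ ≤ z)
    (ht : (trueModel p β₀).card ≤ n) (htd : ((trueModel p β₀).card : ℝ) ≤ d)
    {e : Fin n → ℝ} (hM : ∀ j, |∑ i, X i j * e i| ≤ √n * z) {β : trueModel p β₀ → ℝ}
    (hβ : ∀ i, |β i - β₀ (i : Fin p)| ≤ 1 / √n) :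
    ∑ i, ((X *ᵥ fun j : Fin p => β₀ j) i + e i - (modelMatrix X (trueModel p β₀) *ᵥ β) i) ^ 2 ≤
      ∑ i, e i ^ 2 + 3 * d * z := by
  have hn' : (0 : ℝ) < n := by exact_mod_cast hn
  have hd : 0 ≤ d := (Nat.cast_nonneg _).trans htd
  have hHn : (√n) ^ 2 = (n : ℝ) := Real.sq_sqrt hn'.le
  set H : ℝ := √n
  have hH0 : 0 < H := Real.sqrt_pos.mpr hn'
  let θ : Fin p → ℝ := fun i => extendZero (trueModel p β₀) β i - β₀ i
  have hθ0 : ∀ i ∉ trueModel p β₀, θ i = 0 := fun i hi => by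
    simp only [θ]
    rw [extendZero_of_notMem β hi, Finsupp.notMem_support_iff.mp (mt mem_trueModel.mpr hi),
      sub_zero]
  have hθ1 : ∀ i ∈ trueModel p β₀, |θ i| ≤ 1 / H := fun i hi => by
    simp only [θ]
    rw [extendZero_of_mem β hi]
    exact hβ ⟨i, hi⟩
  have hres := residual_le hX hn ht hθ0 hM
  have h1 : ∑ j, |θ j| ≤ d / H := by
    rw [← Finset.sum_subset (Finset.subset_univ (trueModel p β₀)) (fun i _ hi => by simp [hθ0 i hi])]
    refine (Finset.sum_le_card_nsmul _ _ _ hθ1).trans ?_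
    rw [nsmul_eq_mul, mul_one_div]
    gcongr
  have h2 : ∑ j, θ j ^ 2 ≤ d / H ^ 2 := by
    rw [← Finset.sum_subset (Finset.subset_univ (trueModel p β₀)) (fun i _ hi => by simp [hθ0 i hi])]
    refine (Finset.sum_le_card_nsmul _ _ (1 / H ^ 2) fun i hi => ?_).trans ?_
    · rw [← sq_abs, ← one_div_pow]
      have := hθ1 i hi
      gcongr
    · rw [nsmul_eq_mul, mul_one_div]
      gcongr
  have hz : 0 ≤ z := hε.trans hεz
  have h3 : 2 * (H * z) * ∑ j, |θ j| ≤ 2 * d * z := by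
    calc _ ≤ 2 * (H * z) * (d / H) := by gcongr
      _ = 2 * d * z := by field_simp
  have h4 : n * ε⁻¹ * ∑ i, θ i ^ 2 ≤ d * z := by
    calc _ ≤ H ^ 2 * z * (d / H ^ 2) := by rw [hHn]; gcongr; rw [← hHn]; exact h2
      _ = d * z := by field_simp
  have h5 : ∑ i, ((X *ᵥ fun j : Fin p => β₀ j) i + e i - (modelMatrix X (trueModel p β₀) *ᵥ β) i) ^ 2 =
      ∑ i, (e i - (X *ᵥ θ) i) ^ 2 := by
    refine Finset.sum_congr rfl fun i _ => ?_
    have : (X *ᵥ θ) i = (X *ᵥ extendZero (trueModel p β₀) β) i - (X *ᵥ fun j : Fin p => β₀ j) i := by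
      rw [← Pi.sub_apply, ← Matrix.mulVec_sub]
      rfl
    rw [this, modelMatrix_mulVec]
    ring
  rw [h5]
  linarith

theorem le_invGamma_half {n : ℕ} (hn : 1 ≤ n) {τ : ℝ} (hτ : τ ∈ Set.Icc (√n) (2 * √n)) :
    Real.exp (-((|Real.log ((1 / 2) ^ (1 / 2 : ℝ) / Real.Gamma (1 / 2))| + 3 + 1 / 2) * √n)) ≤
      invGamma (1 / 2) ((n : ℝ) / 2) τ := by
  have hn1 : (1 : ℝ) ≤ n := by exact_mod_cast hn
  have hHn : (√n) ^ 2 = (n : ℝ) := Real.sq_sqrt (by linarith)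
  have hH1 : 1 ≤ √(n : ℝ) := Real.one_le_sqrt.mpr hn1
  set H : ℝ := √n
  have hG2 := Real.Gamma_pos_of_pos (half_pos (one_pos (α := ℝ)))
  have hτ0 : 0 < τ := (one_pos.trans_le hH1).trans_le hτ.1
  set c₂ : ℝ := (1 / 2) ^ (1 / 2 : ℝ) / Real.Gamma (1 / 2) with hc₂def
  have hc₂ : 0 < c₂ := by positivity
  have h1 : -((|Real.log c₂| + 3 + 1 / 2) * H) =
      -(|Real.log c₂| * H) + -(3 * H) + -(1 / 2 * H) := by ring
  rw [h1, Real.exp_add, Real.exp_add, invGamma]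
  have h2 : c₂ ≤ ((n : ℝ) / 2) ^ (1 / 2 : ℝ) / Real.Gamma (1 / 2) := by
    rw [hc₂def]
    gcongr
  -- `log τ ≤ τ - 1 ≤ 2 H`, multiplied by the exponent `3 / 2`.
  have h3 : Real.exp (-(3 * H)) ≤ τ ^ (-((1 / 2 : ℝ) + 1)) := by
    rw [Real.rpow_def_of_pos hτ0, Real.exp_le_exp]
    have := Real.log_le_sub_one_of_pos hτ0
    have := hτ.2
    linarith
  have h4 : Real.exp (-(1 / 2 * H)) ≤ Real.exp (-((n : ℝ) / 2) / τ) := by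
    rw [Real.exp_le_exp, neg_div, neg_le_neg_iff, div_le_iff₀ hτ0, ← hHn]
    have := hτ.1
    nlinarith
  have := (exp_neg_abs_log_mul_le hc₂ hH1).trans h2
  gcongr

set_option maxHeartbeats 1000000 in
/-- The marginal density of the true model is at least `peak n T * exp (-C √n z)`, where `T` is the
sum of the squared errors, on the event that all the products of the errors with the columns of
the design matrix are at most `√n z`. -/
theorem exists_le_marginal_trueModel {r : ℕ} (hr : 1 ≤ r) {α₁ α₂ : ℝ} (hα₁ : 0 < α₁)
    (hα₂ : 0 < α₂) (β₀ : ℕ →₀ ℝ) {σ : ℝ} (hσ : 0 < σ) :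
    ∃ C > 0, ∀ (n p : ℕ) (X : Matrix (Fin n) (Fin p) ℝ) (ε z T : ℝ) (e : Fin n → ℝ), 1 ≤ n →
      0 < ε → EigenvalueBounds X ε → ε⁻¹ ≤ z → C ≤ z → z ≤ √n → (trueModel p β₀).card ≤ n →
      (∀ j, |∑ i, X i j * e i| ≤ √n * z) → T = ∑ i, e i ^ 2 → σ / 2 * n ≤ T → T ≤ 2 * σ * n →
      ENNReal.ofReal (peak n T * Real.exp (-(C * (√n * z)))) ≤
        marginal r α₁ α₂ X (trueModel p β₀)
          (fun i => (X *ᵥ fun j : Fin p => β₀ j) i + e i) := by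
  obtain ⟨b, hb, hb'⟩ := exists_pos_le_of_pos β₀.support (fun i => |β₀ i|)
    (fun i hi => abs_pos.mpr (Finsupp.mem_support_iff.mp hi))
  let B : ℝ := ∑ i ∈ β₀.support, |β₀ i|
  have hB : 0 ≤ B := Finset.sum_nonneg fun _ _ => abs_nonneg _
  have hB' : ∀ i ∈ β₀.support, |β₀ i| ≤ B := fun i hi =>
    Finset.single_le_sum (f := fun i => |β₀ i|) (fun _ _ => abs_nonneg _) hi
  let d : ℝ := β₀.support.card
  have hd : 0 ≤ d := Nat.cast_nonneg _
  have hr' : (0 : ℝ) < r := by exact_mod_cast hr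
  have hG := Real.Gamma_pos_of_pos (half_pos hr')
  have hG2 := Real.Gamma_pos_of_pos (half_pos (one_pos (α := ℝ)))
  have hG3 := Real.Gamma_pos_of_pos hα₁
  let c₁ : ℝ := (σ / 2) ^ ((r : ℝ) / 2) / Real.Gamma ((r : ℝ) / 2) * ((B + 1) ^ (r + 1))⁻¹
  have hc₁ : 0 < c₁ := by positivity
  let c₂ : ℝ := (1 / 2) ^ (1 / 2 : ℝ) / Real.Gamma (1 / 2)
  have hc₂ : 0 < c₂ := by positivity
  let c₃ : ℝ := α₂ ^ α₁ / Real.Gamma α₁ * (4 * σ) ^ (-(α₁ + 1)) * Real.exp (-α₂ / (σ / 2))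
  have hc₃ : 0 < c₃ := by positivity
  have hc₄ : 0 < σ / 2 := half_pos hσ
  let A₁ : ℝ := |Real.log c₁| + 8 * σ / (b / 2) ^ 2
  -- The summands pay, in this order, for the piMOM density, the prior on `τ`, the prior on `s`, the
  -- likelihood and the volume of the box. The last one, `1 + 2 / b`, forces `1 / √n ≤ b / 2`, so
  -- that the box keeps every coefficient at least `b / 2` away from zero.
  let C : ℝ := d * A₁ + (|Real.log c₂| + 3 + 1 / 2) + |Real.log c₃| + (1 / 2 + 3 * d / σ) +
    (|Real.log (σ / 2)| + 2 + d) + (1 + 2 / b)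
  have hA₁ : 0 ≤ A₁ := by positivity
  have hCpos : 0 < C := by positivity
  refine ⟨C, hCpos, fun n p X ε z T e hn hε hX hεz hCz hzn ht hM hTe hT1 hT2 => ?_⟩
  have hC1 : 1 + 2 / b ≤ C := by
    have : 0 ≤ d * A₁ + (|Real.log c₂| + 3 + 1 / 2) + |Real.log c₃| + (1 / 2 + 3 * d / σ) +
      (|Real.log (σ / 2)| + 2 + d) := by positivity
    exact le_add_of_nonneg_left this
  have hb2 : 0 < 2 / b := by positivity
  have hz1 : 1 ≤ z := by linarith
  have hzb : 2 / b ≤ z := by linarith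
  have hn' : (0 : ℝ) < n := by exact_mod_cast hn
  set H : ℝ := √n with hHdef
  have hH1 : 1 ≤ H := hz1.trans hzn
  have hH0 : 0 < H := by linarith
  have hHn : H ^ 2 = n := Real.sq_sqrt hn'.le
  have hHb : 1 / H ≤ b / 2 := by
    rw [div_le_div_iff₀ hH0 two_pos]
    have := hzb.trans hzn
    rw [div_le_iff₀ hb] at this
    linarith
  have hT : 0 < T := lt_of_lt_of_le (by positivity) hT1
  set S : ℝ := T / n with hS
  have hS1 : σ / 2 ≤ S := by rwa [hS, le_div_iff₀ hn']
  have hS2 : S ≤ 2 * σ := by rwa [hS, div_le_iff₀ hn']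
  have hS0 : 0 < S := by linarith
  have hn1 : (1 : ℝ) / n ≤ 1 := by
    rw [div_le_one hn']
    exact_mod_cast hn
  set t := trueModel p β₀ with htdef
  have htd : (t.card : ℝ) ≤ d := Nat.cast_le.mpr (card_trueModel_le p β₀)
  let lo : t → ℝ := fun i => β₀ (i : Fin p) - 1 / H
  let hi : t → ℝ := fun i => β₀ (i : Fin p) + 1 / H
  set v : ℝ := peak n T * Real.exp (-(1 / 2 + 3 * d * z / σ)) *
    Real.exp (-(d * A₁ * H)) * Real.exp (-((|Real.log c₂| + 3 + 1 / 2) * H)) *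
    Real.exp (-(|Real.log c₃| * H)) with hv
  have hpk := peak_pos hn hT
  have hv0 : 0 ≤ v := by positivity
  have key := le_marginal (r := r) (α₁ := α₁) (α₂ := α₂) (X := X) (k := t)
    (y := fun i => (X *ᵥ fun j : Fin p => β₀ j) i + e i) (a := H) (b := 2 * H) (c := S)
    (d := (1 + 1 / n) * S) (v := v) hH0 hS0 (by linarith) hv0 lo hi ?_
  · refine le_trans ?_ key
    have hprod : ∏ i, ENNReal.ofReal (hi i - lo i) = ENNReal.ofReal ((2 / H) ^ t.card) := by
      have : ∀ i, hi i - lo i = 2 / H := fun i => by simp only [hi, lo]; ring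
      simp only [this, Finset.prod_const, Finset.card_univ, Fintype.card_coe]
      rw [ENNReal.ofReal_pow (by positivity)]
    have hw : 0 ≤ (1 + 1 / (n : ℝ)) * S - S := by
      have : 0 ≤ 1 / (n : ℝ) * S := by positivity
      linarith
    rw [hprod, ← ENNReal.ofReal_mul (by
      have : 0 ≤ 2 * H - H := by linarith
      positivity)]
    refine ENNReal.ofReal_le_ofReal ?_
    have hHexp : Real.exp (-H) ≤ 1 / H := by
      rw [Real.exp_neg, ← one_div]
      gcongr
      linarith [Real.add_one_le_exp H]
    have v1 : Real.exp (-((|Real.log (σ / 2)| + 2) * H)) ≤ (2 * H - H) * ((1 + 1 / n) * S - S) := by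
      have h1 : Real.exp (-((|Real.log (σ / 2)| + 2) * H)) =
          Real.exp (-(|Real.log (σ / 2)| * H)) * (Real.exp (-H)) ^ 2 := by
        rw [← Real.exp_nat_mul, ← Real.exp_add]
        push_cast
        ring_nf
      have h2 := exp_neg_abs_log_mul_le hc₄ hH1
      have h3 : (2 * H - H) * ((1 + 1 / n) * S - S) = H * (S * (1 / H) ^ 2) := by
        rw [← hHn]
        field_simp
        ring
      rw [h1, h3]
      calc _ ≤ (σ / 2) * (1 / H) ^ 2 := by gcongr
        _ ≤ S * (1 / H) ^ 2 := by gcongr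
        _ ≤ H * (S * (1 / H) ^ 2) := le_mul_of_one_le_left (by positivity) hH1
    have v2 : Real.exp (-(d * H)) ≤ (2 / H) ^ t.card := by
      calc Real.exp (-(d * H)) ≤ Real.exp (-(t.card * H)) := by
            rw [Real.exp_le_exp, neg_le_neg_iff]
            gcongr
        _ = (Real.exp (-H)) ^ t.card := by rw [← Real.exp_nat_mul, mul_neg]
        _ ≤ (2 / H) ^ t.card := by
            gcongr
            exact hHexp.trans (by gcongr; norm_num)
    have v3 : Real.exp (-(C * (H * z))) ≤ Real.exp (-(1 / 2 + 3 * d * z / σ)) *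
        Real.exp (-(d * A₁ * H)) * Real.exp (-((|Real.log c₂| + 3 + 1 / 2) * H)) *
        Real.exp (-(|Real.log c₃| * H)) * Real.exp (-((|Real.log (σ / 2)| + 2) * H)) *
        Real.exp (-(d * H)) := by
      simp only [← Real.exp_add, Real.exp_le_exp]
      have hHz : H ≤ H * z := le_mul_of_one_le_right hH0.le hz1
      have hHz' : z ≤ H * z := le_mul_of_one_le_left (by linarith) hH1
      have w1 : d * A₁ * H ≤ d * A₁ * (H * z) := by gcongr
      have w2 : (|Real.log c₂| + 3 + 1 / 2) * H ≤ (|Real.log c₂| + 3 + 1 / 2) * (H * z) := by gcongr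
      have w3 : |Real.log c₃| * H ≤ |Real.log c₃| * (H * z) := by gcongr
      have w4 : (|Real.log (σ / 2)| + 2) * H ≤ (|Real.log (σ / 2)| + 2) * (H * z) := by gcongr
      have w5 : d * H ≤ d * (H * z) := by gcongr
      have w6 : 3 * d * z / σ ≤ 3 * d / σ * (H * z) := by
        rw [mul_div_right_comm]
        gcongr
      have w7 : 0 ≤ (1 + 2 / b) * (H * z) := by positivity
      have w8 : (1 : ℝ) / 2 ≤ 1 / 2 * (H * z) := by linarith [hH1.trans hHz]
      have w9 : C * (H * z) = d * A₁ * (H * z) + (|Real.log c₂| + 3 + 1 / 2) * (H * z) +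
        |Real.log c₃| * (H * z) + 1 / 2 * (H * z) + 3 * d / σ * (H * z) +
        (|Real.log (σ / 2)| + 2) * (H * z) + d * (H * z) + (1 + 2 / b) * (H * z) := by
        simp only [C]
        ring
      linarith
    have v4 := (Real.exp_nonneg _).trans v1
    calc peak n T * Real.exp (-(C * (H * z))) ≤ peak n T * _ :=
          mul_le_mul_of_nonneg_left v3 hpk.le
      _ = v * Real.exp (-((|Real.log (σ / 2)| + 2) * H)) * Real.exp (-(d * H)) := by
          rw [hv]; ring
      _ ≤ v * ((2 * H - H) * ((1 + 1 / n) * S - S)) * (2 / H) ^ t.card :=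
          mul_le_mul (mul_le_mul_of_nonneg_left v1 hv0) v2 (Real.exp_nonneg _)
            (mul_nonneg hv0 v4)
      _ = _ := by ring
  · intro τ hτ s hs β hβ
    have hτ0 : 0 < τ := hH0.trans_le hτ.1
    have hs0 : 0 < s := hS0.trans_le hs.1
    have hs4 : s ≤ 4 * σ := by
      calc s ≤ (1 + 1 / n) * S := hs.2
        _ ≤ 2 * (2 * σ) := mul_le_mul (by linarith) hS2 hS0.le two_pos.le
        _ = 4 * σ := by ring
    have hβ1 : ∀ i : t, |β i - β₀ (i : Fin p)| ≤ 1 / H := fun i => by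
      rw [abs_le]
      have h1 := hβ.1 i
      have h2 := hβ.2 i
      simp only [lo, hi] at h1 h2
      constructor <;> linarith
    have hl : peak n T * Real.exp (-(1 / 2 + 3 * d * z / σ)) ≤
        likelihood X t s β (fun i => (X *ᵥ fun j : Fin p => β₀ j) i + e i) := by
      have hΔ : 3 * d * z / (2 * S) ≤ 3 * d * z / σ := by
        gcongr
        linarith
      refine le_trans ?_ (le_likelihood (Δ := 3 * d * z) hn hT (by positivity) hs ?_)
      · gcongr
      · rw [hTe]
        exact residual_trueModel_le hn (inv_nonneg.mpr hε.le) hX hεz ht htd hM hβ1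
    have hp : Real.exp (-(d * A₁ * H)) ≤ piMOM r τ s β := by
      have hτs1 : σ / 2 ≤ τ * s := by
        calc σ / 2 ≤ S := hS1
          _ ≤ s := hs.1
          _ ≤ τ * s := le_mul_of_one_le_left hs0.le (hH1.trans hτ.1)
      have hτs2 : τ * s ≤ 8 * σ * H := by
        calc τ * s ≤ (2 * H) * (4 * σ) := mul_le_mul hτ.2 hs4 hs0.le (by positivity)
          _ = _ := by ring
      refine le_trans ?_ (le_piMOM hr (b := b / 2) (B := B + 1) hc₄ (half_pos hb) hτs1 hτs2
        fun i => ?_)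
      · have h1 : Real.exp (-(A₁ * H)) ≤ c₁ * Real.exp (-(8 * σ * H / (b / 2) ^ 2)) := by
          have : -(A₁ * H) = -(|Real.log c₁| * H) + -(8 * σ * H / (b / 2) ^ 2) := by
            simp only [A₁]
            ring
          rw [this, Real.exp_add]
          gcongr
          exact exp_neg_abs_log_mul_le hc₁ hH1
        calc Real.exp (-(d * A₁ * H)) ≤ Real.exp (-(t.card * (A₁ * H))) := by
              rw [Real.exp_le_exp, mul_assoc]
              gcongr
          _ = Real.exp (-(A₁ * H)) ^ Fintype.card t := by
              rw [Fintype.card_coe, ← Real.exp_nat_mul, mul_neg]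
          _ ≤ _ := by gcongr
      · have h1 := abs_le.mp (hβ1 i)
        have h2 := hb' _ (mem_trueModel.mp i.2)
        have h3 := hB' _ (mem_trueModel.mp i.2)
        have h4 := abs_sub_abs_le_abs_sub (β₀ (i : Fin p)) (β i)
        have h5 := abs_sub_abs_le_abs_sub (β i) (β₀ (i : Fin p))
        have h6 := hβ1 i
        rw [abs_sub_comm] at h4
        have h7 : 1 / H ≤ 1 := by
          rw [div_le_one hH0]
          exact hH1
        constructor <;> linarith
    have hg1 : Real.exp (-((|Real.log c₂| + 3 + 1 / 2) * H)) ≤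
        invGamma (1 / 2) ((n : ℝ) / 2) τ := le_invGamma_half hn hτ
    have hg2 : Real.exp (-(|Real.log c₃| * H)) ≤ invGamma α₁ α₂ s := by
      refine (exp_neg_abs_log_mul_le hc₃ hH1).trans ?_
      simp only [c₃, invGamma]
      have h1 : (4 * σ) ^ (-(α₁ + 1)) ≤ s ^ (-(α₁ + 1)) :=
        Real.rpow_le_rpow_of_nonpos hs0 hs4 (by linarith)
      have h2 : Real.exp (-α₂ / (σ / 2)) ≤ Real.exp (-α₂ / s) := by
        rw [Real.exp_le_exp, neg_div, neg_div, neg_le_neg_iff]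
        have := hS1.trans hs.1
        gcongr
      gcongr
    have hl0 := (by positivity : 0 ≤ peak n T * Real.exp (-(1 / 2 + 3 * d * z / σ))).trans hl
    have hp0 := (Real.exp_nonneg _).trans hp
    have hg0 := (Real.exp_nonneg _).trans hg1
    rw [hv]
    gcongr


/-! ### The upper bound on the marginal density of a wrong model -/

/-- `le_residual` for the difference between `β` and the truth, supported on `k ∪ t`; the cost per
coordinate is `2 z ^ 2 / ε ≤ 2 z ^ 3`. -/
theorem le_residual_model {n p : ℕ} (hn : 1 ≤ n) {X : Matrix (Fin n) (Fin p) ℝ}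
    {β₀ : ℕ →₀ ℝ} {ε z : ℝ} (hε : 0 < ε) (hX : EigenvalueBounds X ε) (hεz : ε⁻¹ ≤ z)
    {k : Finset (Fin p)} (hk : (k ∪ trueModel p β₀).card ≤ n) {e : Fin n → ℝ}
    (hM : ∀ j, |∑ i, X i j * e i| ≤ √n * z) (β : k → ℝ) :
    ∑ i, e i ^ 2 - 2 * (k ∪ trueModel p β₀).card * z ^ 3 +
        n * ε / 2 * ∑ i, (extendZero k β i - β₀ i) ^ 2 ≤
      ∑ i, ((X *ᵥ fun j : Fin p => β₀ j) i + e i - (modelMatrix X k *ᵥ β) i) ^ 2 := by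
  have hn' : (0 : ℝ) < n := by exact_mod_cast hn
  have hz : 0 < z := (inv_pos.mpr hε).trans_le hεz
  let θ : Fin p → ℝ := fun i => extendZero k β i - β₀ i
  have hθ0 : ∀ i ∉ k ∪ trueModel p β₀, θ i = 0 := fun i hi => by
    rw [Finset.mem_union, not_or] at hi
    simp only [θ]
    rw [extendZero_of_notMem β hi.1,
      Finsupp.notMem_support_iff.mp (mt mem_trueModel.mpr hi.2), sub_zero]
  have h1 := le_residual hε hX hn hk hθ0 hM
  have h2 : (√n * z) ^ 2 / (n * ε) ≤ z ^ 3 := by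
    rw [mul_pow, Real.sq_sqrt hn'.le, mul_div_mul_left _ _ hn'.ne', div_eq_mul_inv]
    calc z ^ 2 * ε⁻¹ ≤ z ^ 2 * z := by gcongr
      _ = z ^ 3 := by ring
  have h3 : ∑ i, ((X *ᵥ fun j : Fin p => β₀ j) i + e i - (modelMatrix X k *ᵥ β) i) ^ 2 =
      ∑ i, (e i - (X *ᵥ θ) i) ^ 2 := by
    refine Finset.sum_congr rfl fun i _ => ?_
    have : (X *ᵥ θ) i = (X *ᵥ extendZero k β) i - (X *ᵥ fun j : Fin p => β₀ j) i := by
      rw [← Pi.sub_apply, ← Matrix.mulVec_sub]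
      rfl
    rw [this, modelMatrix_mulVec]
    ring
  rw [h3]
  refine le_trans ?_ h1
  gcongr

theorem two_rpow_mul_sqrt_two_le {r : ℕ} {a z : ℝ} (ha : 0 ≤ a) (hr : (r : ℝ) ≤ z) (hz : 1 ≤ z) :
    (2 : ℝ) ^ ((r : ℝ) * a / 2) * √2 ≤ Real.exp ((a + 1) * z) := by
  have h2 : (2 : ℝ) ≤ Real.exp 1 := by linarith [Real.add_one_le_exp 1]
  have h3 : √2 ≤ Real.exp 1 := (Real.sqrt_le_left (by norm_num)).mpr (by nlinarith) |>.trans h2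
  calc (2 : ℝ) ^ ((r : ℝ) * a / 2) * √2
      ≤ Real.exp 1 ^ ((r : ℝ) * a / 2) * Real.exp 1 := by gcongr
    _ = Real.exp ((r : ℝ) * a / 2 + 1) := by
      rw [Real.exp_one_rpow, ← Real.exp_add]
    _ ≤ Real.exp ((a + 1) * z) := by
      rw [Real.exp_le_exp]
      have : (r : ℝ) * a ≤ z * a := by gcongr
      have : 0 ≤ z * a := by positivity
      nlinarith

theorem marginal_le_of_not_subset {r : ℕ} (hr : 1 ≤ r) {α₁ α₂ : ℝ} (hα₁ : 0 < α₁)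
    (hα₂ : 0 < α₂) {β₀ : ℕ →₀ ℝ} {σ b : ℝ} (hσ : 0 < σ) (hb : 0 < b)
    (hb' : ∀ i ∈ β₀.support, b ≤ |β₀ i|) {n p : ℕ} {X : Matrix (Fin n) (Fin p) ℝ}
    {ε z T : ℝ} {e : Fin n → ℝ} (hn : 1 ≤ n) (hε : 0 < ε) (hX : EigenvalueBounds X ε)
    (hεz : ε⁻¹ ≤ z) (hz8 : 8 ≤ z) (hzr : (r : ℝ) ≤ z) (hzb : 6 / b ^ 2 ≤ z)
    (hzσ : 2 * σ + 1 ≤ z) (hzn : z ^ 20 ≤ √n) (hM : ∀ j, |∑ i, X i j * e i| ≤ √n * z)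
    (hTe : T = ∑ i, e i ^ 2) (hT1 : σ / 2 * n ≤ T) (hT2 : T ≤ 2 * σ * n) {k : Finset (Fin p)}
    (hk : ((k.card : ℝ) + (trueModel p β₀).card + 1) * z ^ 15 ≤ n)
    (hkt : ¬ trueModel p β₀ ⊆ k) :
    marginal r α₁ α₂ X k (fun i => (X *ᵥ fun j : Fin p => β₀ j) i + e i) ≤
      ENNReal.ofReal (peak n T * Real.exp (-(√n * z ^ 2 + (k.card + 1) * z))) := by
  have hn' : (0 : ℝ) < n := by exact_mod_cast hn
  have hz0 : 0 < z := by linarith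
  have hz1 : 1 ≤ z := by linarith
  have hT : 0 < T := lt_of_lt_of_le (by positivity) hT1
  have hHn : √n * √n = (n : ℝ) := Real.mul_self_sqrt hn'.le
  set H : ℝ := √n
  obtain ⟨i₀, hi₀, hi₀k⟩ := Finset.not_subset.mp hkt
  have hcard : ((k ∪ trueModel p β₀).card : ℝ) ≤ k.card + (trueModel p β₀).card := by
    exact_mod_cast Finset.card_union_le _ _
  have hK : ((k ∪ trueModel p β₀).card : ℝ) * z ^ 15 ≤ n := by
    refine le_trans ?_ hk
    gcongr
    linarith
  have hKn : (k ∪ trueModel p β₀).card ≤ n := by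
    have : ((k ∪ trueModel p β₀).card : ℝ) ≤ n :=
      (le_mul_of_one_le_right (Nat.cast_nonneg _) (one_le_pow₀ hz1)).trans hK
    exact_mod_cast this
  -- A missed coefficient raises the residual by at least `3 n / z ^ 2` (from `6 / b ^ 2 ≤ z`), and
  -- the overfit takes back at most `2 n / z ^ 2`.
  set R : ℝ := T + n / z ^ 2 with hRdef
  have hR : 0 < R := by positivity
  have hy : ∀ β : k → ℝ, R + 0 * ∑ i ∈ (∅ : Finset k), β i ^ 2 ≤
      ∑ i, ((X *ᵥ fun j : Fin p => β₀ j) i + e i - (modelMatrix X k *ᵥ β) i) ^ 2 := by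
    intro β
    refine le_trans ?_ (le_residual_model hn hε hX hεz hKn hM β)
    have h1 : b ^ 2 ≤ ∑ i, (extendZero k β i - β₀ i) ^ 2 := by
      refine le_trans ?_ (Finset.single_le_sum (f := fun i : Fin p =>
        (extendZero k β i - β₀ i) ^ 2) (fun _ _ => sq_nonneg _) (Finset.mem_univ i₀))
      rw [extendZero_of_notMem β hi₀k, zero_sub, neg_sq, ← sq_abs (β₀ i₀)]
      have := hb' _ (mem_trueModel.mp hi₀)
      gcongr
    have h2 : z⁻¹ ≤ ε := inv_le_of_inv_le₀ hε hεz
    have h3 : n * z⁻¹ / 2 * b ^ 2 ≤ n * ε / 2 * ∑ i, (extendZero k β i - β₀ i) ^ 2 := by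
      gcongr
    have h4 : 2 * (k ∪ trueModel p β₀).card * z ^ 3 ≤ 2 * (n / z ^ 2) := by
      rw [mul_assoc]
      refine mul_le_mul_of_nonneg_left ?_ two_pos.le
      rw [le_div_iff₀ (by positivity)]
      refine le_trans ?_ hK
      rw [mul_assoc, ← pow_add]
      gcongr
      norm_num
    have h5 : 3 * (n / z ^ 2) ≤ n * z⁻¹ / 2 * b ^ 2 := by
      rw [div_le_iff₀ (by positivity)] at hzb
      have : n * z⁻¹ / 2 * b ^ 2 = n / z ^ 2 * (z * b ^ 2 / 2) := by
        field_simp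
      rw [this, mul_comm]
      gcongr
      linarith
    rw [hRdef, hTe]
    linarith
  refine (marginal_le hn hr hα₁ hα₂ hR le_rfl ∅ 1 hy).trans (ENNReal.ofReal_le_ofReal ?_)
  have hpk := peak_pos hn hT
  have h1 : Real.exp (-min (((∅ : Finset k).card : ℝ) * √0 * √1) ((n : ℝ) / (4 * 1))) = 1 := by
    rw [Finset.card_empty, Nat.cast_zero, zero_mul, zero_mul, min_eq_left (by positivity),
      neg_zero, Real.exp_zero]
  rw [h1, mul_one, mul_assoc]
  have h2 : (n : ℝ) / 2 * (T / R - 1) ≤ -(n / (2 * z ^ 3)) := by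
    have h3 : R ≤ n * z := by
      have : n / z ^ 2 ≤ n := div_le_self hn'.le (one_le_pow₀ hz1)
      nlinarith
    have h4 : T / R - 1 = -(n / z ^ 2 / R) := by
      rw [hRdef]
      field_simp
      ring
    have h5 : 1 / z ^ 3 ≤ n / z ^ 2 / R := by
      rw [le_div_iff₀ hR]
      calc 1 / z ^ 3 * R ≤ 1 / z ^ 3 * (n * z) := by gcongr
        _ = n / z ^ 2 := by field_simp
    have h6 : (n : ℝ) / (2 * z ^ 3) = n / 2 * (1 / z ^ 3) := by field_simp
    rw [h4, h6]
    nlinarith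
  -- One copy of `(|k| + 1) z` pays for `2 ^ (r |k| / 2) √2`, the other is the decay claimed in the
  -- conclusion.
  have h7 : 2 * ((k.card + 1) * z) + H * z ^ 2 ≤ n / (2 * z ^ 3) := by
    rw [le_div_iff₀ (by positivity)]
    have ha : ((k.card : ℝ) + 1) * z ^ 15 ≤ n := by
      refine le_trans ?_ hk
      gcongr
      linarith [Nat.cast_nonneg (α := ℝ) (trueModel p β₀).card]
    have hH : H * z ^ 20 ≤ n := by
      rw [← hHn]
      gcongr
    have e1 : ((k.card : ℝ) + 1) * z ^ 4 * 8 ≤ n := by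
      refine le_trans ?_ ha
      calc ((k.card : ℝ) + 1) * z ^ 4 * 8 ≤ (k.card + 1) * z ^ 4 * z ^ 11 := by
            gcongr
            exact hz8.trans (le_self_pow₀ hz1 (by norm_num))
        _ = _ := by ring
    have e2 : H * z ^ 5 * 4 ≤ n := by
      refine le_trans ?_ hH
      calc H * z ^ 5 * 4 ≤ H * z ^ 5 * z ^ 15 := by
            gcongr
            exact (by linarith : 4 ≤ z).trans (le_self_pow₀ hz1 (by norm_num))
        _ = _ := by ring
    have e3 : (2 * (((k.card : ℝ) + 1) * z) + H * z ^ 2) * (2 * z ^ 3) =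
        (((k.card : ℝ) + 1) * z ^ 4 * 8 + H * z ^ 5 * 4) / 2 := by ring
    linarith
  calc peak n R * (2 ^ ((r : ℝ) * k.card / 2) * √2)
      ≤ (peak n T * Real.exp ((n : ℝ) / 2 * (T / R - 1))) * Real.exp ((k.card + 1) * z) :=
        mul_le_mul (peak_le_peak_mul_exp hn hR hT)
          (two_rpow_mul_sqrt_two_le (Nat.cast_nonneg _) hzr hz1) (by positivity) (by positivity)
    _ = peak n T * Real.exp ((n : ℝ) / 2 * (T / R - 1) + (k.card + 1) * z) := by
        rw [Real.exp_add]; ring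
    _ ≤ _ := by
        gcongr
        linarith

theorem marginal_le_of_ssubset {r : ℕ} (hr : 1 ≤ r) {α₁ α₂ : ℝ} (hα₁ : 0 < α₁)
    (hα₂ : 0 < α₂) {β₀ : ℕ →₀ ℝ} {σ : ℝ} (hσ : 0 < σ) {n p : ℕ} {X : Matrix (Fin n) (Fin p) ℝ}
    {ε z T : ℝ} {e : Fin n → ℝ} (hn : 1 ≤ n) (hε : 0 < ε) (hX : EigenvalueBounds X ε)
    (hεz : ε⁻¹ ≤ z) (hz16 : 16 ≤ z) (hzr : (r : ℝ) ≤ z) (hzσ : 8 / σ ≤ z)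
    (hzt : (β₀.support.card : ℝ) + 1 ≤ z) (hzn : z ^ 20 ≤ √n)
    (hM : ∀ j, |∑ i, X i j * e i| ≤ √n * z)
    (hTe : T = ∑ i, e i ^ 2) (hT1 : σ / 2 * n ≤ T) {k : Finset (Fin p)}
    (hk : ((k.card : ℝ) + (trueModel p β₀).card + 1) * z ^ 15 ≤ n)
    (hkt : trueModel p β₀ ⊂ k) :
    marginal r α₁ α₂ X k (fun i => (X *ᵥ fun j : Fin p => β₀ j) i + e i) ≤
      ENNReal.ofReal (peak n T * Real.exp (-(√n * z ^ 2 + (k.card + 1) * z))) := by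
  have hn' : (0 : ℝ) < n := by exact_mod_cast hn
  have hz0 : 0 < z := by linarith
  have hz1 : 1 ≤ z := by linarith
  have hT : 0 < T := lt_of_lt_of_le (by positivity) hT1
  have hHn : √n * √n = (n : ℝ) := Real.mul_self_sqrt hn'.le
  set H : ℝ := √n
  have hH0 : 0 < H := Real.sqrt_pos.mpr hn'
  have hKk : k ∪ trueModel p β₀ = k := Finset.union_eq_left.mpr hkt.subset
  have ha : ((k.card : ℝ) + 1) * z ^ 15 ≤ n := by
    refine le_trans ?_ hk
    gcongr
    linarith [Nat.cast_nonneg (α := ℝ) (trueModel p β₀).card]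
  have hkz : (k.card : ℝ) * z ^ 15 ≤ n := by
    refine le_trans ?_ ha
    gcongr
    linarith
  have hKn : (k ∪ trueModel p β₀).card ≤ n := by
    rw [hKk]
    have : (k.card : ℝ) ≤ n :=
      (le_mul_of_one_le_right (Nat.cast_nonneg _) (one_le_pow₀ hz1)).trans hkz
    exact_mod_cast this
  let J : Finset k := Finset.univ.filter fun i => (i : Fin p) ∉ trueModel p β₀
  have hJ1 : 1 ≤ J.card := by
    obtain ⟨i, hi, hi'⟩ := Finset.exists_of_ssubset hkt
    exact Finset.card_pos.mpr ⟨⟨i, hi⟩, by simp [J, hi']⟩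
  -- The penalty is proportional to the number of superfluous coefficients, the costs to `|k|`. Up
  -- to a factor `2 z` the former controls the latter, as `J` is nonempty and the size of the true
  -- model is below `z`.
  have hJk : (k.card : ℝ) + 1 ≤ 2 * (J.card * z) := by
    have h1 : k.card ≤ J.card + β₀.support.card := by
      have h2 := Finset.card_filter_add_card_filter_not (s := (Finset.univ : Finset k))
        (fun i => (i : Fin p) ∉ trueModel p β₀)
      have h3 : (Finset.univ.filter fun i : k => ¬ (i : Fin p) ∉ trueModel p β₀).card ≤
          (trueModel p β₀).card :=
        Finset.card_le_card_of_injOn (fun i => (i : Fin p))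
          (fun i hi => by simpa using hi) Subtype.val_injective.injOn
      have h4 := card_trueModel_le p β₀
      rw [Finset.card_univ, Fintype.card_coe] at h2
      simp only [J]
      omega
    have h1' : (k.card : ℝ) ≤ J.card + β₀.support.card := by exact_mod_cast h1
    have hJ1' : (1 : ℝ) ≤ J.card := by exact_mod_cast hJ1
    nlinarith
  set D : ℝ := 2 * k.card * z ^ 3 with hDdef
  have hD0 : 0 ≤ D := by positivity
  have hDT : D ≤ T / 2 := by
    have h1 : k.card * z ^ 4 ≤ n := by
      refine le_trans ?_ hkz
      gcongr
      norm_num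
    have h2 : 8 ≤ σ * z := by
      rw [div_le_iff₀ hσ] at hzσ
      linarith
    have h3 : D * 8 ≤ D * (σ * z) := by gcongr
    have h4 : D * (σ * z) = 2 * σ * (k.card * z ^ 4) := by rw [hDdef]; ring
    have h5 : 2 * σ * (k.card * z ^ 4) ≤ 2 * σ * n := by gcongr
    linarith
  have hR : 0 < T - D := by linarith
  have hh : 0 ≤ n * ε / 2 := by positivity
  have hy : ∀ β : k → ℝ, (T - D) + n * ε / 2 * ∑ i ∈ J, β i ^ 2 ≤
      ∑ i, ((X *ᵥ fun j : Fin p => β₀ j) i + e i - (modelMatrix X k *ᵥ β) i) ^ 2 := by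
    intro β
    have h1 := le_residual_model hn hε hX hεz hKn hM β
    rw [hKk] at h1
    refine le_trans ?_ h1
    rw [hTe]
    gcongr
    have h2 : ∑ i ∈ J, β i ^ 2 = ∑ i ∈ J, (extendZero k β i - β₀ (i : Fin p)) ^ 2 := by
      refine Finset.sum_congr rfl fun i hi => ?_
      have hi' : (i : Fin p) ∉ trueModel p β₀ := by simpa [J] using hi
      rw [extendZero_of_mem β i.2,
        Finsupp.notMem_support_iff.mp (mt mem_trueModel.mpr hi'), sub_zero]
    rw [h2]
    refine (Finset.sum_map J (Function.Embedding.subtype _)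
      (fun i : Fin p => (extendZero k β i - β₀ i) ^ 2)).symm.le.trans ?_
    exact Finset.sum_le_sum_of_subset_of_nonneg (Finset.subset_univ _) fun _ _ _ => sq_nonneg _
  -- `τ₀ = z ^ 8` is large enough for the penalty `|J| (√n / z) z ^ 4` to beat `√n z ^ 2` and `|k| z
  -- ^ 4`, and small enough for `n / (4 z ^ 8)` to beat both as well.
  refine (marginal_le hn hr hα₁ hα₂ hR hh J (z ^ 8) hy).trans (ENNReal.ofReal_le_ofReal ?_)
  have hpk := peak_pos hn hT
  have h2 : (n : ℝ) / 2 * (T / (T - D) - 1) ≤ k.card * z ^ 4 := by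
    have h3 : T / (T - D) - 1 = D / (T - D) := by
      field_simp
      ring
    have h4 : σ / 4 * n ≤ T - D := by linarith
    have h5 : 8 ≤ σ * z := by
      rw [div_le_iff₀ hσ] at hzσ
      linarith
    rw [h3]
    calc (n : ℝ) / 2 * (D / (T - D)) ≤ n / 2 * (D / (σ / 4 * n)) := by gcongr
      _ = 4 / σ * (k.card * z ^ 3) := by
        rw [hDdef]
        field_simp
      _ ≤ z * (k.card * z ^ 3) := by
        gcongr
        refine le_trans ?_ hzσ
        gcongr
        norm_num
      _ = _ := by ring
  have hHz : ((k.card : ℝ) + 1) * z ^ 4 * 3 + H * z ^ 2 ≤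
      min (J.card * √(n * ε / 2) * √(z ^ 8)) ((n : ℝ) / (4 * z ^ 8)) := by
    have hH : H * z ^ 20 ≤ n := by
      rw [← hHn]
      gcongr
    have hJ1' : (1 : ℝ) ≤ J.card := by exact_mod_cast hJ1
    refine le_min ?_ ?_
    · have e1 : √(z ^ 8) = z ^ 4 := by
        rw [show z ^ 8 = (z ^ 4) ^ 2 by ring, Real.sqrt_sq (by positivity)]
      have e2 : H / z ≤ √(n * ε / 2) := by
        refine Real.le_sqrt_of_sq_le ?_
        have h2 : z⁻¹ ≤ ε := inv_le_of_inv_le₀ hε hεz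
        calc (H / z) ^ 2 = n * z⁻¹ * (1 / z) := by
              rw [div_pow, sq, hHn]
              field_simp
          _ ≤ n * ε * (1 / 2) := by
              gcongr
              linarith
          _ = _ := by ring
      have e3 : J.card * H * z ^ 3 ≤ J.card * √(n * ε / 2) * √(z ^ 8) := by
        rw [e1]
        calc J.card * H * z ^ 3 = J.card * (H / z) * z ^ 4 := by field_simp
          _ ≤ _ := by gcongr
      refine le_trans ?_ e3
      have e4 : ((k.card : ℝ) + 1) * z ^ 4 * 3 ≤ J.card * H := by
        calc ((k.card : ℝ) + 1) * z ^ 4 * 3 ≤ 2 * (J.card * z) * z ^ 4 * 3 := by gcongr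
          _ = J.card * (6 * z ^ 5) := by ring
          _ ≤ J.card * H := by
            gcongr
            refine le_trans ?_ hzn
            calc 6 * z ^ 5 ≤ z * z ^ 5 := by gcongr; linarith
              _ = z ^ 6 := by ring
              _ ≤ z ^ 20 := by
                gcongr
                norm_num
      have e5 : H * z ^ 2 ≤ J.card * H * z ^ 2 := by
        gcongr
        exact le_mul_of_one_le_left hH0.le hJ1'
      have e6 : J.card * H ≤ J.card * H * z ^ 2 :=
        le_mul_of_one_le_right (by positivity) (one_le_pow₀ hz1)
      calc ((k.card : ℝ) + 1) * z ^ 4 * 3 + H * z ^ 2 ≤ J.card * H * z ^ 2 * 2 := by linarith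
        _ ≤ J.card * H * z ^ 2 * z := by gcongr; linarith
        _ = _ := by ring
    · rw [le_div_iff₀ (by positivity)]
      have e1 : ((k.card : ℝ) + 1) * z ^ 12 * 24 ≤ n := by
        refine le_trans ?_ ha
        calc ((k.card : ℝ) + 1) * z ^ 12 * 24 ≤ (k.card + 1) * z ^ 12 * z ^ 3 := by
              gcongr
              nlinarith [mul_le_mul hz16 hz16 (by norm_num) hz0.le]
          _ = _ := by ring
      have e2 : H * z ^ 10 * 8 ≤ n := by
        refine le_trans ?_ hH
        calc H * z ^ 10 * 8 ≤ H * z ^ 10 * z ^ 10 := by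
              gcongr
              exact (by linarith : 8 ≤ z).trans (le_self_pow₀ hz1 (by norm_num))
          _ = _ := by ring
      have e3 : (((k.card : ℝ) + 1) * z ^ 4 * 3 + H * z ^ 2) * (4 * z ^ 8) =
          (((k.card : ℝ) + 1) * z ^ 12 * 24 + H * z ^ 10 * 8) / 2 := by ring
      linarith
  have h8 : k.card * z ^ 4 + (k.card + 1) * z + (H * z ^ 2 + (k.card + 1) * z) ≤
      min (J.card * √(n * ε / 2) * √(z ^ 8)) ((n : ℝ) / (4 * z ^ 8)) := by
    refine le_trans ?_ hHz
    have : ((k.card : ℝ) + 1) * z ≤ (k.card + 1) * z ^ 4 := by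
      gcongr
      exact le_self_pow₀ hz1 (by norm_num)
    have : (k.card : ℝ) * z ^ 4 ≤ (k.card + 1) * z ^ 4 := by
      gcongr
      linarith
    linarith
  set L := min (J.card * √(n * ε / 2) * √(z ^ 8)) ((n : ℝ) / (4 * z ^ 8))
  calc peak n (T - D) * 2 ^ ((r : ℝ) * k.card / 2) * √2 * Real.exp (-L)
      = peak n (T - D) * (2 ^ ((r : ℝ) * k.card / 2) * √2) * Real.exp (-L) := by ring
    _ ≤ (peak n T * Real.exp ((n : ℝ) / 2 * (T / (T - D) - 1))) * Real.exp ((k.card + 1) * z) *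
          Real.exp (-L) := by
        refine mul_le_mul_of_nonneg_right ?_ (Real.exp_nonneg _)
        exact mul_le_mul (peak_le_peak_mul_exp hn hR hT)
          (two_rpow_mul_sqrt_two_le (Nat.cast_nonneg _) hzr hz1) (by positivity) (by positivity)
    _ = peak n T * Real.exp ((n : ℝ) / 2 * (T / (T - D) - 1) + (k.card + 1) * z + -L) := by
        rw [Real.exp_add, Real.exp_add]; ring
    _ ≤ _ := by
        gcongr
        linarith


/-! ### The posterior probability of the true model -/

/-- By the binomial theorem the sum is `ρ (1 + ρ) ^ p ≤ ρ exp (p ρ)`. -/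
theorem sum_powerset_pow_le {p : ℕ} {ρ : ℝ} (hρ : 0 ≤ ρ) (hpρ : p * ρ ≤ 1) :
    ∑ k : Finset (Fin p), ρ ^ (k.card + 1) ≤ 3 * ρ := by
  have h1 : ∑ k : Finset (Fin p), ρ ^ k.card = (1 + ρ) ^ p := by
    have := Finset.prod_one_add (f := fun _ : Fin p => ρ) Finset.univ
    simpa using this.symm
  have h2 : (1 + ρ) ^ p ≤ 3 := by
    calc (1 + ρ) ^ p ≤ Real.exp ρ ^ p := by
          gcongr
          linarith [Real.add_one_le_exp ρ]
      _ = Real.exp (p * ρ) := by rw [Real.exp_nat_mul]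
      _ ≤ Real.exp 1 := by gcongr
      _ ≤ 3 := by linarith [Real.exp_one_lt_d9]
  simp_rw [pow_succ]
  rw [← Finset.sum_mul, h1]
  gcongr

/-- With `x = 3 ρ / w`, the denominator is at most `1 + x` times the term of the true model, and `1
- x ≤ 1 / (1 + x)`. -/
theorem one_sub_le_posterior {n p r : ℕ} {α₁ α₂ : ℝ} {prior : PMF (Finset (Fin p))}
    {X : Matrix (Fin n) (Fin p) ℝ} {t : Finset (Fin p)} {y : Fin n → ℝ} {w ρ : ℝ} (hw : 0 < w)
    (hρ : 0 ≤ ρ) (hpρ : p * ρ ≤ 1) (hm0 : marginal r α₁ α₂ X t y ≠ 0)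
    (hm : marginal r α₁ α₂ X t y ≠ ∞)
    (hprior : ∀ k, 0 < prior k → w < (prior t).toReal / (prior k).toReal)
    (hk : ∀ k, k ≠ t → prior k ≠ 0 →
      marginal r α₁ α₂ X k y ≤ ENNReal.ofReal (ρ ^ (k.card + 1)) * marginal r α₁ α₂ X t y) :
    1 - 3 * ρ / w ≤ posterior r α₁ α₂ prior X t y ∧ posterior r α₁ α₂ prior X t y ≤ 1 := by
  have ht0 : prior t ≠ 0 := by
    obtain ⟨k, hk⟩ := prior.support_nonempty
    intro h
    have := hprior k (pos_iff_ne_zero.mpr hk)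
    rw [h, ENNReal.toReal_zero, zero_div] at this
    linarith
  set A : ℝ≥0∞ := prior t * marginal r α₁ α₂ X t y with hA
  have hA0 : A ≠ 0 := mul_ne_zero ht0 hm0
  have hAtop : A ≠ ∞ := ENNReal.mul_ne_top (prior.apply_ne_top t) hm
  set S : ℝ≥0∞ := ∑ l, prior l * marginal r α₁ α₂ X l y with hS
  have hAS : A ≤ S := Finset.single_le_sum
    (f := fun l => prior l * marginal r α₁ α₂ X l y) (fun _ _ => zero_le) (Finset.mem_univ t)
  have hSA : S ≤ A * ENNReal.ofReal (1 + 3 * ρ / w) := by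
    have h1 : ∀ k, prior k * marginal r α₁ α₂ X k y ≤
        (if k = t then A else 0) + A * ENNReal.ofReal (w⁻¹ * ρ ^ (k.card + 1)) := by
      intro k
      split_ifs with h
      · rw [h]
        exact le_self_add
      · rw [zero_add]
        by_cases hk0 : prior k = 0
        · simp [hk0]
        have h2 : prior k ≤ ENNReal.ofReal w⁻¹ * prior t := by
          have h3 := hprior k (pos_iff_ne_zero.mpr hk0)
          have h4 : 0 < (prior k).toReal := ENNReal.toReal_pos hk0 (prior.apply_ne_top k)
          rw [lt_div_iff₀ h4] at h3
          rw [← ENNReal.ofReal_toReal (prior.apply_ne_top k),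
            ← ENNReal.ofReal_toReal (prior.apply_ne_top t), ← ENNReal.ofReal_mul (by positivity)]
          refine ENNReal.ofReal_le_ofReal ?_
          rw [inv_mul_eq_div, le_div_iff₀ hw]
          linarith
        calc prior k * marginal r α₁ α₂ X k y
            ≤ (ENNReal.ofReal w⁻¹ * prior t) *
              (ENNReal.ofReal (ρ ^ (k.card + 1)) * marginal r α₁ α₂ X t y) :=
              mul_le_mul' h2 (hk k h hk0)
          _ = _ := by
              rw [hA, ENNReal.ofReal_mul (by positivity)]
              ring
    refine (Finset.sum_le_sum fun k _ => h1 k).trans ?_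
    rw [Finset.sum_add_distrib, Finset.sum_ite_eq' , if_pos (Finset.mem_univ _), ← Finset.mul_sum,
      ← ENNReal.ofReal_sum_of_nonneg (fun _ _ => by positivity), ← Finset.mul_sum,
      ENNReal.ofReal_add one_pos.le (by positivity), ENNReal.ofReal_one, mul_add, mul_one]
    gcongr
    calc w⁻¹ * ∑ k : Finset (Fin p), ρ ^ (k.card + 1) ≤ w⁻¹ * (3 * ρ) := by
          gcongr
          exact sum_powerset_pow_le hρ hpρ
      _ = 3 * ρ / w := by ring
  have hStop : S ≠ ∞ := ne_top_of_le_ne_top (ENNReal.mul_ne_top hAtop ENNReal.ofReal_ne_top) hSA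
  have ha : 0 < A.toReal := ENNReal.toReal_pos hA0 hAtop
  have h1 : A.toReal ≤ S.toReal := ENNReal.toReal_mono hStop hAS
  have h2 : S.toReal ≤ A.toReal * (1 + 3 * ρ / w) := by
    have := ENNReal.toReal_mono (ENNReal.mul_ne_top hAtop ENNReal.ofReal_ne_top) hSA
    rwa [ENNReal.toReal_mul, ENNReal.toReal_ofReal (by positivity)] at this
  have hs : 0 < S.toReal := ha.trans_le h1
  rw [posterior, ENNReal.toReal_div]
  refine ⟨?_, (div_le_one hs).mpr h1⟩
  rw [le_div_iff₀ hs]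
  have hc : 0 ≤ 3 * ρ / w := by positivity
  rcases le_total (1 - 3 * ρ / w) 0 with h | h
  · nlinarith
  · calc (1 - 3 * ρ / w) * S.toReal ≤ (1 - 3 * ρ / w) * (A.toReal * (1 + 3 * ρ / w)) := by gcongr
      _ = A.toReal * (1 - (3 * ρ / w) ^ 2) := by ring
      _ ≤ A.toReal * 1 := by
        gcongr
        linarith [sq_nonneg (3 * ρ / w)]
      _ = A.toReal := mul_one _

/-- On the event that the errors are well behaved, the posterior probability of the true model is
at least `1 - 3 exp (-z) / w`. -/
theorem exists_one_sub_le_posterior {r : ℕ} (hr : 1 ≤ r) {α₁ α₂ : ℝ} (hα₁ : 0 < α₁)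
    (hα₂ : 0 < α₂) (β₀ : ℕ →₀ ℝ) {σ w : ℝ} (hσ : 0 < σ) (hw : 0 < w) :
    ∃ C, ∀ (n p : ℕ) (X : Matrix (Fin n) (Fin p) ℝ) (prior : PMF (Finset (Fin p))) (ε z T : ℝ)
      (e : Fin n → ℝ), 1 ≤ n → 0 < ε → EigenvalueBounds X ε → ε⁻¹ ≤ z → C ≤ z → z ^ 20 ≤ √n →
      (∀ k, prior k ≠ 0 → ((k.card : ℝ) + β₀.support.card + 1) * z ^ 15 ≤ n) →
      (∀ k, 0 < prior k → w < (prior (trueModel p β₀)).toReal / (prior k).toReal) →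
      p * Real.exp (-z) ≤ 1 →
      (∀ j, |∑ i, X i j * e i| ≤ √n * z) → T = ∑ i, e i ^ 2 → σ / 2 * n ≤ T → T ≤ 2 * σ * n →
      1 - 3 * Real.exp (-z) / w ≤ posterior r α₁ α₂ prior X (trueModel p β₀)
        (fun i => (X *ᵥ fun j : Fin p => β₀ j) i + e i) ∧
      posterior r α₁ α₂ prior X (trueModel p β₀)
        (fun i => (X *ᵥ fun j : Fin p => β₀ j) i + e i) ≤ 1 := by
  obtain ⟨b, hb, hb'⟩ := exists_pos_le_of_pos β₀.support (fun i => |β₀ i|)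
    (fun i hi => abs_pos.mpr (Finsupp.mem_support_iff.mp hi))
  obtain ⟨C₀, hC₀, hlow⟩ := exists_le_marginal_trueModel hr hα₁ hα₂ β₀ hσ
  -- The sum of all the lower thresholds for `z` required by the bounds on the marginals.
  refine ⟨C₀ + 16 + r + 6 / b ^ 2 + (2 * σ + 1) + 8 / σ + (β₀.support.card + 1),
    fun n p X prior ε z T e hn hε hX hεz hCz hzn hprior_k hprior hpz hM hTe hT1 hT2 => ?_⟩
  have hr0 : (0 : ℝ) ≤ r := Nat.cast_nonneg _
  have hd0 : (0 : ℝ) ≤ β₀.support.card := Nat.cast_nonneg _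
  have hb0 : 0 ≤ 6 / b ^ 2 := by positivity
  have hσ0 : 0 ≤ 8 / σ := by positivity
  have hz0 : 0 < z := by linarith
  have hz1 : 1 ≤ z := by linarith
  have hn' : (0 : ℝ) < n := by exact_mod_cast hn
  have hT : 0 < T := lt_of_lt_of_le (by positivity) hT1
  have hpk := peak_pos hn hT
  have htd : ((trueModel p β₀).card : ℝ) ≤ β₀.support.card :=
    Nat.cast_le.mpr (card_trueModel_le p β₀)
  have hk : ∀ k, prior k ≠ 0 → ((k.card : ℝ) + (trueModel p β₀).card + 1) * z ^ 15 ≤ n :=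
    fun k h => le_trans (by gcongr) (hprior_k k h)
  have ht0 : prior (trueModel p β₀) ≠ 0 := by
    obtain ⟨k, hk⟩ := prior.support_nonempty
    intro h
    have := hprior k (pos_iff_ne_zero.mpr hk)
    rw [h, ENNReal.toReal_zero, zero_div] at this
    linarith
  have htn : (trueModel p β₀).card ≤ n := by
    have h1 := hk _ ht0
    have h2 : ((trueModel p β₀).card : ℝ) ≤ n := by
      refine le_trans ?_ h1
      refine le_trans ?_ (le_mul_of_one_le_right (by positivity) (one_le_pow₀ hz1))
      linarith [Nat.cast_nonneg (α := ℝ) (trueModel p β₀).card]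
    exact_mod_cast h2
  have hlow' : ENNReal.ofReal (peak n T * Real.exp (-(√n * z ^ 2))) ≤
      marginal r α₁ α₂ X (trueModel p β₀) (fun i => (X *ᵥ fun j : Fin p => β₀ j) i + e i) := by
    refine le_trans (ENNReal.ofReal_le_ofReal ?_) (hlow n p X ε z T e hn hε hX hεz (by linarith)
      ((le_self_pow₀ hz1 (by norm_num)).trans hzn) htn hM hTe hT1 hT2)
    rw [show √n * z ^ 2 = z * (√n * z) by ring]
    gcongr
    linarith
  have hup : ∀ k, prior k ≠ 0 → k ≠ trueModel p β₀ →
      marginal r α₁ α₂ X k (fun i => (X *ᵥ fun j : Fin p => β₀ j) i + e i) ≤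
        ENNReal.ofReal (peak n T * Real.exp (-(√n * z ^ 2 + (k.card + 1) * z))) := by
    intro k hk0 hkt
    by_cases hsub : trueModel p β₀ ⊆ k
    · exact marginal_le_of_ssubset hr hα₁ hα₂ hσ hn hε hX hεz (by linarith) (by linarith)
        (by linarith) (by linarith) hzn hM hTe hT1 (hk k hk0)
        (lt_of_le_of_ne hsub (Ne.symm hkt))
    · exact marginal_le_of_not_subset hr hα₁ hα₂ hσ hb hb' hn hε hX hεz (by linarith)
        (by linarith) (by linarith) (by linarith) hzn hM hTe hT1 hT2 (hk k hk0) hsub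
  refine one_sub_le_posterior hw (Real.exp_nonneg _) hpz ?_ ?_ hprior fun k hkt hk0 => ?_
  · exact (lt_of_lt_of_le (ENNReal.ofReal_pos.mpr (by positivity)) hlow').ne'
  -- Finiteness of the marginal of the true model: its residual stays above `T / 2`, so
  -- `marginal_le` applies without any penalty.
  · have hzD : 2 * ((trueModel p β₀).card : ℝ) * z ^ 3 ≤ T / 2 := by
      have h1 := hk _ ht0
      have h2 : ((trueModel p β₀).card : ℝ) * z ^ 4 ≤ n := by
        refine le_trans ?_ h1
        gcongr
        · linarith [Nat.cast_nonneg (α := ℝ) (trueModel p β₀).card]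
        · norm_num
      have h3 : 8 ≤ σ * z := by
        have : 8 / σ ≤ z := by linarith
        rw [div_le_iff₀ hσ] at this
        linarith
      have h4 : 2 * ((trueModel p β₀).card : ℝ) * z ^ 3 * 8 ≤
          2 * (trueModel p β₀).card * z ^ 3 * (σ * z) := by gcongr
      have h5 : 2 * ((trueModel p β₀).card : ℝ) * z ^ 3 * (σ * z) ≤ 2 * σ * n := by
        calc _ = 2 * σ * ((trueModel p β₀).card * z ^ 4) := by ring
          _ ≤ _ := by gcongr
      linarith
    refine ne_top_of_le_ne_top ENNReal.ofReal_ne_top (marginal_le hn hr hα₁ hα₂ (half_pos hT)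
      le_rfl ∅ 1 fun β => ?_)
    refine le_trans ?_ (le_residual_model hn hε hX hεz (k := trueModel p β₀)
      (by rwa [Finset.union_self]) hM β)
    rw [Finset.union_self, ← hTe]
    have : 0 ≤ n * ε / 2 * ∑ i, (extendZero (trueModel p β₀) β i - β₀ i) ^ 2 := by positivity
    linarith
  · refine (hup k hk0 hkt).trans ?_
    refine le_trans (le_of_eq ?_) (mul_le_mul_right hlow' _)
    rw [← ENNReal.ofReal_mul (by positivity), neg_add, Real.exp_add, ← Real.exp_nat_mul]
    congr 1
    push_cast
    ring_nf


/-! ### Concentration of the errors -/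

section Concentration

variable {Ω : Type*} [MeasurableSpace Ω] {P : Measure Ω} {v : ℝ≥0}

theorem hasSubgaussianMGF_of_hasLaw {Y : Ω → ℝ} (hY : HasLaw Y (gaussianReal 0 v) P) :
    HasSubgaussianMGF Y v P where
  integrable_exp_mul t := by
    have h : Integrable (fun x : ℝ => Real.exp (t * x)) (Measure.map Y P) := by
      rw [hY.map_eq]
      exact integrable_exp_mul_gaussianReal t
    exact h.comp_aemeasurable hY.aemeasurable
  mgf_le t := by
    rw [mgf_gaussianReal hY.map_eq]
    simp

theorem HasSubgaussianMGF.mono {Y : Ω → ℝ} {c c' : ℝ≥0} (hY : HasSubgaussianMGF Y c P)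
    (h : c ≤ c') : HasSubgaussianMGF Y c' P where
  integrable_exp_mul := hY.integrable_exp_mul
  mgf_le t := (hY.mgf_le t).trans (by gcongr)

variable [IsProbabilityMeasure P]

/-- A linear combination of independent centred Gaussians is sub-Gaussian with parameter `v ∑ a i ^
2`; the Chernoff bound is applied to both tails. The exponential rate is what survives the union
over the columns. -/
theorem measure_lt_abs_sum_mul_le {n : ℕ} {err : Fin n → Ω → ℝ}
    (hlaw : ∀ i, HasLaw (err i) (gaussianReal 0 v) P) (hindep : iIndepFun err P) {a : Fin n → ℝ}
    {c M : ℝ} (hc : ∑ i, a i ^ 2 ≤ c) (hM : 0 ≤ M) :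
    P {ω | M < |∑ i, a i * err i ω|} ≤
      ENNReal.ofReal (2 * Real.exp (-M ^ 2 / (2 * (c * v)))) := by
  have hc0 : 0 ≤ c := (Finset.sum_nonneg fun _ _ => sq_nonneg _).trans hc
  have h1 : HasSubgaussianMGF (fun ω => ∑ i, a i * err i ω) (⟨c, hc0⟩ * v) P := by
    refine HasSubgaussianMGF.mono (HasSubgaussianMGF.sum_of_iIndepFun (s := Finset.univ)
      (hindep.comp (fun i x => a i * x) fun i => measurable_const_mul _)
      fun i _ => (hasSubgaussianMGF_of_hasLaw (hlaw i)).const_mul (a i)) ?_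
    rw [← NNReal.coe_le_coe, NNReal.coe_sum]
    change ∑ i, a i ^ 2 * (v : ℝ) ≤ c * v
    rw [← Finset.sum_mul]
    gcongr
  have h2 := h1.measure_ge_le hM
  have h3 := h1.neg.measure_ge_le hM
  have h4 : {ω | M < |∑ i, a i * err i ω|} ⊆ {ω | M ≤ ∑ i, a i * err i ω} ∪
      {ω | M ≤ (-fun ω => ∑ i, a i * err i ω) ω} := by
    intro ω hω
    rcases lt_abs.mp (show M < |∑ i, a i * err i ω| from hω) with h | h
    · exact Or.inl h.le
    · exact Or.inr h.le
  have h5 : P.real {ω | M < |∑ i, a i * err i ω|} ≤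
      2 * Real.exp (-M ^ 2 / (2 * (c * v))) := by
    refine (measureReal_mono h4).trans ((measureReal_union_le _ _).trans ?_)
    rw [two_mul]
    exact add_le_add h2 h3
  rw [← ofReal_measureReal]
  exact ENNReal.ofReal_le_ofReal h5

/-- Chebyshev is enough here, as the event is a single one for each `n`. -/
theorem measure_sum_sq_sub_le {n : ℕ} {err : Fin n → Ω → ℝ}
    (hlaw : ∀ i, HasLaw (err i) (gaussianReal 0 v) P) (hindep : iIndepFun err P) {c : ℝ}
    (hc : 0 < c) :
    P {ω | c ≤ |∑ i, err i ω ^ 2 - n * v|} ≤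
      ENNReal.ofReal (n * Var[fun x => x ^ 2; gaussianReal 0 v] / c ^ 2) := by
  have hL : ∀ i, MemLp (fun ω => err i ω ^ 2) 2 P := fun i => by
    have h4 : MemLp (err i) ((4 : ℕ) : ℝ≥0∞) P := by
      have := (hasSubgaussianMGF_of_hasLaw (hlaw i)).memLp 4
      exact_mod_cast this
    rw [memLp_two_iff_integrable_sq
      ((hlaw i).aemeasurable.pow_const 2).aestronglyMeasurable]
    refine (h4.integrable_norm_pow (by norm_num)).congr (ae_of_all _ fun ω => ?_)
    simp only [Real.norm_eq_abs]
    rw [← pow_mul]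
    exact (by decide : Even 4).pow_abs _
  have hsq : ∀ i, HasLaw (fun ω => err i ω ^ 2)
      ((gaussianReal 0 v).map fun x => x ^ 2) P := fun i =>
    ⟨(hlaw i).aemeasurable.pow_const 2, by
      rw [← (hlaw i).map_eq, AEMeasurable.map_map_of_aemeasurable (by fun_prop)
        (hlaw i).aemeasurable]
      rfl⟩
  have hvar : ∀ i, Var[fun ω => err i ω ^ 2; P] = Var[fun x => x ^ 2; gaussianReal 0 v] := by
    intro i
    rw [(hsq i).variance_eq, variance_map aemeasurable_id (by fun_prop)]
    rfl
  have hmean : ∀ i, ∫ ω, err i ω ^ 2 ∂P = v := by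
    intro i
    have h1 := (hlaw i).variance_eq
    have h2 := (hlaw i).integral_eq
    rw [integral_id_gaussianReal] at h2
    rw [variance_id_gaussianReal, variance_of_integral_eq_zero (hlaw i).aemeasurable h2] at h1
    exact h1
  have hsum : MemLp (∑ i, fun ω => err i ω ^ 2) 2 P := memLp_finsetSum' _ fun i _ => hL i
  have h1 := meas_ge_le_variance_div_sq hsum hc
  have h2 : Var[∑ i, fun ω => err i ω ^ 2; P] = n * Var[fun x => x ^ 2; gaussianReal 0 v] := by
    rw [IndepFun.variance_sum (fun i _ => hL i) fun i _ j _ hij =>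
      (hindep.comp (fun _ x => x ^ 2) fun _ => by fun_prop).indepFun hij]
    simp [hvar]
  have h3 : ∫ ω, (∑ i, fun ω => err i ω ^ 2) ω ∂P = n * v := by
    simp only [Finset.sum_apply]
    rw [integral_finsetSum _ fun i _ => (hL i).integrable (by norm_num)]
    simp [hmean]
  rw [h2, h3] at h1
  simpa only [Finset.sum_apply] using h1

/-- The errors are orthogonal to the columns of the design matrix up to `√n z`, and the sum of
their squares is of the order of `n`, outside of an event of small probability. -/
theorem measure_compl_good_le {n p : ℕ} (hn : 1 ≤ n) (hv : 0 < v) {X : Matrix (Fin n) (Fin p) ℝ}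
    {ε z : ℝ} (hε : 0 < ε) (hX : EigenvalueBounds X ε) (hεz : ε⁻¹ ≤ z) {err : Fin n → Ω → ℝ}
    (hlaw : ∀ i, HasLaw (err i) (gaussianReal 0 v) P) (hindep : iIndepFun err P) :
    P {ω | ¬ ((∀ j, |∑ i, X i j * err i ω| ≤ √n * z) ∧ v / 2 * n ≤ ∑ i, err i ω ^ 2 ∧
        ∑ i, err i ω ^ 2 ≤ 2 * v * n)} ≤
      ENNReal.ofReal (p * (2 * Real.exp (-(z / (2 * v))))) +
        ENNReal.ofReal (Var[fun x => x ^ 2; gaussianReal 0 v] / (v / 2) ^ 2 / n) := by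
  have hn' : (0 : ℝ) < n := by exact_mod_cast hn
  have hv' : (0 : ℝ) < v := by exact_mod_cast hv
  have hz : 0 < z := (inv_pos.mpr hε).trans_le hεz
  have hsub : {ω | ¬ ((∀ j, |∑ i, X i j * err i ω| ≤ √n * z) ∧
        v / 2 * n ≤ ∑ i, err i ω ^ 2 ∧ ∑ i, err i ω ^ 2 ≤ 2 * v * n)} ⊆
      (⋃ j, {ω | √n * z < |∑ i, X i j * err i ω|}) ∪
        {ω | (v : ℝ) / 2 * n ≤ |∑ i, err i ω ^ 2 - n * v|} := by
    intro ω hω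
    by_contra h
    simp only [Set.mem_union, Set.mem_iUnion, Set.mem_ofPred_eq, not_or, not_exists, not_lt,
      not_le] at h
    have h2 := abs_lt.mp h.2
    exact hω ⟨h.1, by linarith, by nlinarith⟩
  refine (measure_mono hsub).trans ((measure_union_le _ _).trans (add_le_add ?_ ?_))
  · refine (measure_iUnion_fintype_le _ _).trans ?_
    have h1 : ∀ j, P {ω | √n * z < |∑ i, X i j * err i ω|} ≤
        ENNReal.ofReal (2 * Real.exp (-(z / (2 * v)))) := by
      intro j
      refine (measure_lt_abs_sum_mul_le hlaw hindep ((hX.sum_sq_column hn j).trans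
        (mul_le_mul_of_nonneg_left hεz hn'.le)) (by positivity)).trans
        (ENNReal.ofReal_le_ofReal (le_of_eq ?_))
      congr 2
      rw [neg_div, mul_pow, Real.sq_sqrt hn'.le]
      field_simp
    refine (Finset.sum_le_sum fun j _ => h1 j).trans (le_of_eq ?_)
    rw [Finset.sum_const, Finset.card_univ, Fintype.card_fin, nsmul_eq_mul,
      ENNReal.ofReal_mul (Nat.cast_nonneg p), ENNReal.ofReal_natCast]
  · refine (measure_sum_sq_sub_le hlaw hindep (by positivity)).trans
      (ENNReal.ofReal_le_ofReal (le_of_eq ?_))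
    field_simp

end Concentration


/-! ### Growth rates -/

theorem tendsto_natCast_rpow_atTop {η : ℝ} (hη : 0 < η) :
    Tendsto (fun n : ℕ => (n : ℝ) ^ η) atTop atTop :=
  (tendsto_rpow_atTop hη).comp tendsto_natCast_atTop_atTop

theorem tendsto_mul_exp_neg_rpow {p : ℕ → ℕ} {γ η c : ℝ} (hη : 0 < η) (hc : 0 < c)
    (hp : (fun n => (p n : ℝ)) =O[atTop] fun n : ℕ => (n : ℝ) ^ γ) :
    Tendsto (fun n : ℕ => (p n : ℝ) * Real.exp (-((n : ℝ) ^ η * c))) atTop (𝓝 0) := by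
  have h1 := (tendsto_rpow_mul_exp_neg_mul_atTop_nhds_zero (γ / η) c hc).comp
    (tendsto_natCast_rpow_atTop hη)
  have h2 : (fun n : ℕ => (p n : ℝ) * Real.exp (-((n : ℝ) ^ η * c))) =O[atTop]
      fun n : ℕ => (n : ℝ) ^ γ * Real.exp (-((n : ℝ) ^ η * c)) :=
    hp.mul (isBigO_refl _ _)
  refine h2.trans_tendsto (h1.congr fun n => ?_)
  simp only [Function.comp]
  rw [← Real.rpow_mul (Nat.cast_nonneg n), mul_div_cancel₀ _ hη.ne', neg_mul, mul_comm c]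

theorem eventually_le_rpow_of_log_rate {u : ℕ → ℝ} {s η : ℝ} (hη : 0 < η)
    (hu : u =O[atTop] fun n : ℕ => (Real.log n) ^ s) : ∀ᶠ n : ℕ in atTop, u n ≤ (n : ℝ) ^ η := by
  have h := hu.trans_isLittleO
    ((isLittleO_log_rpow_rpow_atTop s hη).comp_tendsto tendsto_natCast_atTop_atTop)
  filter_upwards [h.bound one_pos] with n hn
  rw [one_mul, Function.comp, Real.norm_of_nonneg (Real.rpow_nonneg (Nat.cast_nonneg n) η)] at hn
  exact (le_abs_self _).trans hn

theorem exists_eventually_add_mul_le {q : ℕ → ℝ} {ξ : ℝ} (hξ : ξ < 1)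
    (hq : q =O[atTop] fun n : ℕ => (n : ℝ) ^ ξ) (a : ℝ) :
    ∃ η : ℝ, 0 < η ∧ (∀ᶠ n : ℕ in atTop, ((n : ℝ) ^ η) ^ 20 ≤ √n) ∧
      ∀ᶠ n : ℕ in atTop, (q n + a + 1) * ((n : ℝ) ^ η) ^ 15 ≤ n := by
  -- Truncating at `0` lets `n ^ ξ'` absorb the constants `a + 1`.
  set ξ' : ℝ := max ξ 0 with hξ'
  -- In the next choice, `1 / 40` gives `20 η ≤ 1 / 2`, and `16` is `15` plus one more power of `n ^
  -- η` that swallows the constant `|C| + |a| + 1`.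
  have h1 : ξ' < 1 := max_lt hξ one_pos
  set η : ℝ := min (1 / 40) ((1 - ξ') / 16) with hηdef
  have hη : 0 < η := lt_min (by norm_num) (by linarith)
  refine ⟨η, hη, ?_, ?_⟩
  · filter_upwards [eventually_ge_atTop 1] with n hn
    have hn1 : (1 : ℝ) ≤ n := by exact_mod_cast hn
    rw [← Real.rpow_natCast, ← Real.rpow_mul (by linarith), Real.sqrt_eq_rpow]
    refine Real.rpow_le_rpow_of_exponent_le hn1 ?_
    have := min_le_left (1 / 40) ((1 - ξ') / 16)
    push_cast
    linarith
  · obtain ⟨C, hC⟩ := hq.bound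
    filter_upwards [hC, eventually_ge_atTop 1,
      (tendsto_natCast_rpow_atTop hη).eventually_ge_atTop (|C| + |a| + 1)] with n hqn hn hCn
    have hn1 : (1 : ℝ) ≤ n := by exact_mod_cast hn
    have hn0 : (0 : ℝ) < n := by linarith
    have h2 : q n ≤ |C| * (n : ℝ) ^ ξ' := by
      refine (le_abs_self _).trans (hqn.trans ?_)
      rw [Real.norm_of_nonneg (Real.rpow_nonneg hn0.le ξ)]
      exact mul_le_mul (le_abs_self C) (Real.rpow_le_rpow_of_exponent_le hn1 (le_max_left _ _))
        (Real.rpow_nonneg hn0.le _) (abs_nonneg _)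
    have h3 : 1 ≤ (n : ℝ) ^ ξ' := Real.one_le_rpow hn1 (le_max_right _ _)
    have h4 : q n + a + 1 ≤ (n : ℝ) ^ η * (n : ℝ) ^ ξ' := by
      calc q n + a + 1 ≤ |C| * (n : ℝ) ^ ξ' + |a| * (n : ℝ) ^ ξ' + 1 * (n : ℝ) ^ ξ' := by
            have := (le_abs_self a).trans (le_mul_of_one_le_right (abs_nonneg a) h3)
            linarith
        _ = (|C| + |a| + 1) * (n : ℝ) ^ ξ' := by ring
        _ ≤ _ := by gcongr
    calc (q n + a + 1) * ((n : ℝ) ^ η) ^ 15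
        ≤ ((n : ℝ) ^ η * (n : ℝ) ^ ξ') * ((n : ℝ) ^ η) ^ 15 := by gcongr
      _ = (n : ℝ) ^ (η * 16 + ξ') := by
        rw [Real.rpow_add hn0, Real.rpow_mul hn0.le]
        norm_cast
        ring
      _ ≤ (n : ℝ) ^ (1 : ℝ) := by
        refine Real.rpow_le_rpow_of_exponent_le hn1 ?_
        have := min_le_right (1 / 40) ((1 - ξ') / 16)
        linarith
      _ = n := Real.rpow_one _

end HyperPiMOM

theorem corollary1
    -- order of the piMOM prior, hyperparameters of the prior on the variance
    (r : ℕ) (hr : 1 ≤ r) (α₁ α₂ : ℝ) (hα₁ : 0 < α₁) (hα₂ : 0 < α₂)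
    -- dimensions, design matrices, priors on the models
    (p : ℕ → ℕ) (X : ∀ n, Matrix (Fin n) (Fin (p n)) ℝ)
    (prior : ∀ n, PMF (Finset (Fin (p n))))
    -- true coefficients and true variance, fixed in n
    (β₀ : ℕ →₀ ℝ) (hβ₀ : ∀ n, 1 ≤ n → β₀.support ⊆ Finset.range (p n))
    (σ₀sq : ℝ≥0) (hσ₀ : 0 < σ₀sq)
    -- i.i.d. Gaussian errors for every n
    {Ω : Type*} [MeasurableSpace Ω] (P : Measure Ω) [IsProbabilityMeasure P]
    (err : ∀ n, Fin n → Ω → ℝ)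
    (herr_law : ∀ n i, HasLaw (err n i) (gaussianReal 0 σ₀sq) P)
    (herr_indep : ∀ n, iIndepFun (err n) P)
    -- eigenvalues of the submatrices of the design
    (ε : ℕ → ℝ) (hε : ∀ n, 1 ≤ n → 0 < ε n ∧ ε n < 1)
    (hεX : ∀ n, 1 ≤ n → HyperPiMOM.EigenvalueBounds (X n) (ε n))
    (hε_rate : (fun n => (ε n)⁻¹) =O[atTop] fun n : ℕ => (Real.log n) ^ ((1 : ℝ) / 8))
    -- growth of the dimension
    (γ : ℝ) (hγ : γ < r)
    (hp : (fun n => (p n : ℝ)) =O[atTop] fun n : ℕ => (n : ℝ) ^ γ)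
    -- no prior mass on large models
    (q : ℕ → ℝ) (ξ : ℝ) (hξ : ξ < 1) (hξγ : ξ < 1 - 4 * γ / (3 * r))
    (hq : q =O[atTop] fun n : ℕ => (n : ℝ) ^ ξ)
    (hprior_q : ∀ n, 1 ≤ n → ∀ k : Finset (Fin (p n)), q n < (k.card : ℝ) → prior n k = 0)
    -- prior ratios bounded below
    (w : ℝ) (hw : 0 < w)
    (hprior_w : ∀ n, 1 ≤ n → ∀ k : Finset (Fin (p n)), 0 < prior n k →
      w < (prior n (HyperPiMOM.trueModel (p n) β₀)).toReal / (prior n k).toReal) :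
    TendstoInMeasure P
      (fun n ω => HyperPiMOM.posterior r α₁ α₂ (prior n) (X n)
        (HyperPiMOM.trueModel (p n) β₀)
        (fun i => (X n *ᵥ fun j : Fin (p n) => β₀ j) i + err n i ω))
      atTop (fun _ => 1) := by

  obtain ⟨η, hη, hη20, hη15⟩ :=
    HyperPiMOM.exists_eventually_add_mul_le hξ hq (β₀.support.card : ℝ)
  have hv : (0 : ℝ) < σ₀sq := by exact_mod_cast hσ₀
  obtain ⟨C, hC⟩ := HyperPiMOM.exists_one_sub_le_posterior hr hα₁ hα₂ β₀ hv hw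
  have hz := HyperPiMOM.tendsto_natCast_rpow_atTop hη
  intro δ hδ
  have hexp : Tendsto (fun n : ℕ => ENNReal.ofReal (3 * Real.exp (-(n : ℝ) ^ η) / w)) atTop
      (𝓝 0) := by
    have h1 : Tendsto (fun n : ℕ => 3 * Real.exp (-(n : ℝ) ^ η) / w) atTop (𝓝 (3 * 0 / w)) :=
      ((Real.tendsto_exp_neg_atTop_nhds_zero.comp hz).const_mul 3).div_const w
    simpa using (ENNReal.tendsto_ofReal h1)
  have hbad : Tendsto (fun n : ℕ =>
      ENNReal.ofReal (p n * (2 * Real.exp (-((n : ℝ) ^ η / (2 * σ₀sq))))) +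
        ENNReal.ofReal (Var[fun x => x ^ 2; gaussianReal 0 σ₀sq] / (σ₀sq / 2) ^ 2 / n))
      atTop (𝓝 0) := by
    have h1 : Tendsto (fun n : ℕ => (p n : ℝ) * (2 * Real.exp (-((n : ℝ) ^ η / (2 * σ₀sq)))))
        atTop (𝓝 0) := by
      have := (HyperPiMOM.tendsto_mul_exp_neg_rpow hη
        (show (0 : ℝ) < (2 * (σ₀sq : ℝ))⁻¹ by positivity) hp).const_mul 2
      rw [mul_zero] at this
      refine this.congr fun n => ?_
      rw [div_eq_mul_inv]
      ring
    simpa using (ENNReal.tendsto_ofReal h1).add (ENNReal.tendsto_ofReal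
      (tendsto_const_div_atTop_nhds_zero_nat
        (Var[fun x => x ^ 2; gaussianReal 0 σ₀sq] / (σ₀sq / 2) ^ 2)))
  have hpz : ∀ᶠ n : ℕ in atTop, (p n : ℝ) * Real.exp (-(n : ℝ) ^ η) ≤ 1 := by
    have := (HyperPiMOM.tendsto_mul_exp_neg_rpow hη one_pos hp).eventually_le_const one_pos
    simpa using this
  refine tendsto_of_tendsto_of_tendsto_of_le_of_le' tendsto_const_nhds hbad
    (Eventually.of_forall fun _ => zero_le) ?_
  filter_upwards [hη20, hη15, hpz, HyperPiMOM.eventually_le_rpow_of_log_rate hη hε_rate,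
    hz.eventually_ge_atTop C, hexp.eventually_lt_const hδ, eventually_ge_atTop 1]
    with n h20 h15 hpn hεn hCn hδn hn
  have hn0 : (0 : ℝ) ≤ n := Nat.cast_nonneg n
  refine (measure_mono ?_).trans (HyperPiMOM.measure_compl_good_le hn hσ₀ (hε n hn).1 (hεX n hn)
    hεn (herr_law n) (herr_indep n))
  -- On the good event the posterior is within `3 exp (-z) / w` of one, which is below `δ` for large
  -- `n`; a deviation of size `δ` therefore forces the bad event.
  intro ω hω hgood
  obtain ⟨hlow, hup⟩ := hC n (p n) (X n) (prior n) (ε n) ((n : ℝ) ^ η) _ (fun i => err n i ω) hn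
    (hε n hn).1 (hεX n hn) hεn hCn h20 (fun k hk => by
      refine le_trans ?_ h15
      have hkq : (k.card : ℝ) ≤ q n := not_lt.mp fun h => hk (hprior_q n hn k h)
      gcongr) (hprior_w n hn) hpn hgood.1 rfl hgood.2.1 hgood.2.2
  refine absurd hδn (not_lt.mpr (le_trans (show δ ≤ _ from hω) ?_))
  rw [edist_dist, Real.dist_eq, abs_sub_comm, abs_of_nonneg (by linarith)]
  exact ENNReal.ofReal_le_ofReal (by linarith)
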